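/- **Setting.** Let $I\subset\mathbb{R}$ and $J=[0,\infty)$, and put $B_R=\{x\in I:|x|<R\}$. Let $(T^t)_{t\in J}$ be a family of linear operators on $L^2(I)$ with $T^0f=f$, where $T^tf$ is given by an integral formula for $t>0$. For $a>0$ let $$M_af(x)=\frac1a\int_0^a T^tf(x)\,dt .$$ A set $F\subset L^2(I)$ is called *equicontinuous in mean with respect to $T$* if both of the following hold: 1. for all $\varepsilon>0$ and $M_0>0$ there is $\delta>0$ such that $\|T^{t+h}f-T^tf\|_{L^2(I)}<\varepsilon$ for all $f\in F$, all $0\le t<M_0$ and all real $h$ with $|h|\le\delta$ and $t+h\ge0$; 2. for all $\varepsilon,a,R>0$ there is $\delta>0$ such that $|M_af(x+h)-M_af(x)|<\varepsilon$ for all $f\in F$, all $|h|\le\delta$ and all $x$ with $x,\,x+h\in B_R$. **Statement.** All functions are complex-valued. The following two assertions hold. (i) *Heat translation, Fourier transform.* Let $I=\mathbb{R}$, $b>0$, and for $t>0$ $$T^tf(x)=\int_{\mathbb{R}}f(\xi)\,\frac{e^{-(x-\xi)^2/(4b^2t)}}{2b\sqrt{\pi}\sqrt{t}}\,d\xi .$$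 Let $K\subset L^2(\mathbb{R})$ be bounded and let $\hat K=\{\hat f: f\in K\}$, where $\hat f(z)=\int_{\mathbb{R}}f(x)e^{-ixz}\,dx$ is the Fourier transform, extended by continuity to $L^2(\mathbb{R})$. Then $K$ is precompact (i.e. has compact closure) in $L^2(\mathbb{R})$ if and only if both $K$ and $\hat K$ are equicontinuous in mean with respect to $T$. (ii) *Poisson translation, cosine transform.* Let $I=(0,\infty)$, extend functions on $I$ to even functions on $\mathbb{R}$, and for $t>0$ let $$T^tf(x)=\frac1\pi\int_{\mathbb{R}}f(|\xi|)\,\frac{t}{(\xi-x)^2+t^2}\,d\xi .$$ Let $K\subset L^2(0,\infty)$ be bounded and let $\hat K=\{\hat f: f\in K\}$, where $\hat f(z)=\int_{\mathbb{R}}f(|x|)\cos(xz)\,dx=2\int_0^\infty f(x)\cos(xz)\,dx$ is the cosine transform, extended by continuity to $L^2(0,\infty)$. Then $K$ is precompact in $L^2(0,\infty)$ if and only if both $K$ and $\hat K$ are equicontinuous in mean with respect to $T$. -/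

import Mathlib

open MeasureTheory Set FourierTransform
open scoped ENNReal

/-- The ball `B_a = {s ∈ S : |s| < a}` of radius `a` about the origin, relative to `S ⊆ ℝ`. -/
def relBall (S : Set ℝ) (a : ℝ) : Set ℝ := {s ∈ S | |s| < a}

/-- Property `(P_b1)` for a set `F` of functions on `I`: the maps `t ↦ T^t f` from the parameter set
`J` to `L^p_μ(I)` are continuous, uniformly in `f ∈ F` and in `t` in bounded subsets of `J`. -/
def EquicontinuousInTime (T : ℝ → (ℝ → ℂ) → ℝ → ℂ) (I J : Set ℝ) (μ : Measure ℝ) (p : ℝ≥0∞)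
    (F : Set (ℝ → ℂ)) : Prop :=
  ∀ ε > (0 : ℝ), ∀ M₀ > (0 : ℝ), ∃ δ > (0 : ℝ), ∀ t ∈ relBall J M₀, ∀ h : ℝ, |h| ≤ δ → t + h ∈ J →
    ∀ f ∈ F, eLpNorm (fun x => T (t + h) f x - T t f x) p (μ.restrict I) < ENNReal.ofReal ε

/-- The average `M_a f(x) = (1/ν(B_a)) ∫_{B_a} T^t f(x) dν(t)` of the translates of `f`,
where `B_a = {t ∈ J : |t| < a}`. -/
noncomputable def translateAverage (T : ℝ → (ℝ → ℂ) → ℝ → ℂ) (J : Set ℝ) (ν : Measure ℝ)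
    (a : ℝ) (f : ℝ → ℂ) (x : ℝ) : ℂ :=
  (ν.real (relBall J a))⁻¹ • ∫ t in relBall J a, T t f x ∂ν

/-- Property `(P_b2)` for a set `F` of functions on `I`: for all `a, R > 0`, the averages `M_a f`,
`f ∈ F`, are uniformly equicontinuous on `B_R = {x ∈ I : |x| < R}`. -/
def EquicontinuousAverages (T : ℝ → (ℝ → ℂ) → ℝ → ℂ) (I J : Set ℝ) (ν : Measure ℝ)
    (F : Set (ℝ → ℂ)) : Prop :=
  ∀ ε > (0 : ℝ), ∀ a > (0 : ℝ), ∀ R > (0 : ℝ), ∃ δ > (0 : ℝ), ∀ h : ℝ, |h| ≤ δ →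
    ∀ f ∈ F, ∀ x ∈ relBall I R, x + h ∈ relBall I R →
      ‖translateAverage T J ν a f (x + h) - translateAverage T J ν a f x‖ < ε

/-- `F` is equicontinuous in mean with respect to the translation `T`. -/
def EquicontinuousInMean (T : ℝ → (ℝ → ℂ) → ℝ → ℂ) (I J : Set ℝ) (μ ν : Measure ℝ) (p : ℝ≥0∞)
    (F : Set (ℝ → ℂ)) : Prop :=
  EquicontinuousInTime T I J μ p F ∧ EquicontinuousAverages T I J ν F

/-- The heat translation with parameter `b`:
`T^t f(x) = ∫ f(ξ) exp(-(x-ξ)²/(4b²t)) / (2b√π√t) dξ` for `t > 0`, and `T^0 f = f`. -/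
noncomputable def heatTranslation (b t : ℝ) (f : ℝ → ℂ) (x : ℝ) : ℂ :=
  if t = 0 then f x else
    ∫ ξ, (Real.exp (-(x - ξ) ^ 2 / (4 * b ^ 2 * t)) / (2 * b * √Real.pi * √t)) • f ξ

/-- The Poisson translation on the line: `T^t f(x) = (1/π) ∫ f(ξ) t / ((ξ-x)² + t²) dξ`
for `t > 0`, and `T^0 f = f`. -/
noncomputable def poissonTranslation (t : ℝ) (f : ℝ → ℂ) (x : ℝ) : ℂ :=
  if t = 0 then f x else Real.pi⁻¹ • ∫ ξ, (t / ((ξ - x) ^ 2 + t ^ 2)) • f ξ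

/-- The Poisson translation of a function on `(0, ∞)`, i.e. that of its even extension. -/
noncomputable def poissonTranslationHalfLine (t : ℝ) (f : ℝ → ℂ) (x : ℝ) : ℂ :=
  poissonTranslation t (fun ξ => f |ξ|) x

/-- The Fourier transform on `L²(ℝ)` normalized by `f̂(z) = ∫ f(x) e^{-ixz} dx`. Mathlib's `𝓕` is the
extension to `L²` of `w ↦ ∫ f(x) e^{-2πixw} dx`, so that `f̂(z) = 𝓕 f (z / 2π)`. -/
noncomputable def fourierL2 (f : Lp ℂ 2 (volume : Measure ℝ)) (z : ℝ) : ℂ :=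
  (𝓕 f : Lp ℂ 2 (volume : Measure ℝ)) (z / (2 * Real.pi))

theorem memLp_evenExtension (f : Lp ℂ 2 (volume.restrict (Ioi (0 : ℝ)))) :
    MemLp (fun x : ℝ => f |x|) 2 volume := by
  have h1 : MemLp ((Ioi (0 : ℝ)).indicator f) 2 volume :=
    (memLp_indicator_iff_restrict measurableSet_Ioi).2 (Lp.memLp f)
  have h2 : MemLp ((Ioi (0 : ℝ)).indicator f ∘ Neg.neg) 2 volume :=
    h1.comp_measurePreserving (Measure.measurePreserving_neg volume)
  refine (h1.add h2).ae_eq ?_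
  have h0 : ∀ᵐ x : ℝ, x ≠ 0 := by simp [ae_iff]
  filter_upwards [h0] with x hx
  rcases lt_or_gt_of_ne hx with h | h
  · simp [indicator, h, not_lt.2 h.le, abs_of_neg h]
  · simp [indicator, h, not_lt.2 h.le, abs_of_pos h]

/-- The even extension of `f ∈ L²(0, ∞)` to an element of `L²(ℝ)`. -/
noncomputable def evenExtension (f : Lp ℂ 2 (volume.restrict (Ioi (0 : ℝ)))) :
    Lp ℂ 2 (volume : Measure ℝ) :=
  (memLp_evenExtension f).toLp _

/-- The cosine transform on `L²(0, ∞)` normalized by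
`f̂(z) = ∫_ℝ f(x) cos(xz) dx = 2 ∫_0^∞ f(x) cos(xz) dx`, with `f` extended evenly to `ℝ`;
here `cos(xz) = (e^{-ixz} + e^{ixz}) / 2`, and the `L²` Fourier transform integrates against the two
exponentials. -/
noncomputable def cosineL2 (f : Lp ℂ 2 (volume.restrict (Ioi (0 : ℝ)))) (z : ℝ) : ℂ :=
  (fourierL2 (evenExtension f) z + fourierL2 (evenExtension f) (-z)) / 2

/-! On the Fourier side both translations are multiplication by `exp (-t φ)`, with `φ w = b² (2πw)²`
for heat and `φ w = 2π|w|` for Poisson (`IsMultiplierTranslation`). By Plancherel the increment `T^s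
f - T^t f` has the norm of `(exp (-sφ) - exp (-tφ)) 𝓕⁻ f`. For a bounded family, continuity in time
is therefore equivalent to uniformly small `L²` tails of the transforms: beyond a large radius `1 -
exp (-δφ)` is at least `1/2`, while at bounded frequencies the multiplier is Lipschitz in time
(`equicontinuousInTime_iff`).

The condition on the averages holds for every bounded family. The multiplier of `M_a` is bounded by
`1` and by `1 / (a φ)`, hence lies in `L²`, and Cauchy–Schwarz gives a modulus of continuity
depending only on `a` and the norm bound (`equicontinuousAverages`).

The condition on `K` thus says that the transforms of `K` have small tails. The condition on `K̂`
says the same of `K`, because transforming back returns `f` up to a dilation. By Pego's theorem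
(`totallyBounded_of_uniformlySmallTails`) the two together amount to precompactness of a bounded
set.

On the half line, even extension multiplies distances by `√2` and turns the cosine transform into
the Fourier transform, so (ii) reduces to the Poisson translation on the line. -/

/-! ### The Fourier transform on `L²(ℝ)` -/

/-- The Hilbert space `L²(ℝ)`. -/
abbrev LineL2 : Type := Lp ℂ 2 (volume : Measure ℝ)

/-- The `L²` transform agrees with the transform of tempered distributions, which is defined by this
duality. -/
theorem integral_smul_fourier_coeFn (f : LineL2) (ψ : SchwartzMap ℝ ℂ) :
    ∫ x, ψ x • (𝓕 f : LineL2) x = ∫ x, (𝓕 (ψ : ℝ → ℂ)) x • f x := by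
  have h := congrArg (fun D : TemperedDistribution ℝ ℂ => D ψ)
    (Lp.fourier_toTemperedDistribution_eq f)
  simp only [TemperedDistribution.fourier_apply, Lp.toTemperedDistribution_apply,
    SchwartzMap.fourier_coe] at h
  exact h.symm

/-- Smooth compactly supported functions separate locally integrable ones, so the duality formula
characterises `𝓕 f`. Explicit candidates for a transform are identified in this way. -/
theorem coeFn_fourier_ae_eq {f : LineL2} {u : ℝ → ℂ} (hu : LocallyIntegrable u)
    (h : ∀ ψ : SchwartzMap ℝ ℂ, ∫ x, ψ x • u x = ∫ x, (𝓕 (ψ : ℝ → ℂ)) x • f x) :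
    (𝓕 f : LineL2) =ᵐ[volume] u := by
  refine ae_eq_of_integral_contDiff_smul_eq
    ((Lp.memLp (𝓕 f : LineL2)).locallyIntegrable (by norm_num)) hu fun g hg hgc => ?_
  have hgc' : HasCompactSupport (fun x => (g x : ℂ)) := hgc.comp_left (g := Complex.ofReal) rfl
  have hg' : ContDiff ℝ (⊤ : ℕ∞) (fun x => (g x : ℂ)) := Complex.ofRealCLM.contDiff.comp hg
  have key := (integral_smul_fourier_coeFn f (hgc'.toSchwartzMap hg')).trans
    (h (hgc'.toSchwartzMap hg')).symm
  simpa using key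

theorem continuous_fourier_of_integrable {p : ℝ → ℂ} (hp : Integrable p) :
    Continuous (𝓕 p : ℝ → ℂ) :=
  VectorFourier.fourierIntegral_continuous Real.continuous_fourierChar
    (by exact continuous_inner) hp

/-- On `L¹ ∩ L²` the Fourier transform of `L²` is given by the Fourier integral. -/
theorem coeFn_fourier_toLp {p : ℝ → ℂ} (hp : Integrable p) (hp2 : MemLp p 2 volume) :
    (𝓕 (hp2.toLp p) : LineL2) =ᵐ[volume] (𝓕 p : ℝ → ℂ) := by
  refine coeFn_fourier_ae_eq (continuous_fourier_of_integrable hp).locallyIntegrable fun ψ => ?_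
  have h1 : ∫ x, (𝓕 (ψ : ℝ → ℂ)) x • hp2.toLp p x = ∫ x, (𝓕 (ψ : ℝ → ℂ)) x • p x :=
    integral_congr_ae (hp2.coeFn_toLp.mono fun x hx => by simp only [hx])
  rw [h1]
  have h2 := VectorFourier.integral_fourierIntegral_smul_eq_flip (L := innerₗ ℝ)
    Real.continuous_fourierChar (by exact continuous_inner) (ψ.integrable (μ := volume)) hp
  rw [flip_innerₗ] at h2
  exact h2.symm

theorem memLp_comp_mul_left {a : ℝ} (ha : a ≠ 0) {f : ℝ → ℂ} {p : ℝ≥0∞}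
    (hf : MemLp f p volume) : MemLp (fun x => f (a * x)) p volume := by
  have h : MemLp f p (Measure.map (fun x => a * x) volume) := by
    rw [Real.map_volume_mul_left ha]
    exact hf.smul_measure ENNReal.ofReal_ne_top
  exact (memLp_map_measure_iff h.1 (measurable_const_mul a).aemeasurable).1 h

/-- The dilation `x ↦ f (a x)` of a function in `L²(ℝ)`. -/
noncomputable def dilate (a : ℝ) (ha : a ≠ 0) (f : LineL2) : LineL2 :=
  (memLp_comp_mul_left ha (Lp.memLp f)).toLp _

theorem coeFn_dilate {a : ℝ} (ha : a ≠ 0) (f : LineL2) :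
    dilate a ha f =ᵐ[volume] fun x => f (a * x) :=
  MemLp.coeFn_toLp _

theorem ae_eq_comp_mul_left {a : ℝ} (ha : a ≠ 0) {f g : ℝ → ℂ} (h : f =ᵐ[volume] g) :
    (fun x => f (a * x)) =ᵐ[volume] fun x => g (a * x) := by
  have hq : Measure.QuasiMeasurePreserving (fun x : ℝ => a * x) volume volume :=
    ⟨measurable_const_mul a, by
      rw [Real.map_volume_mul_left ha]; exact Measure.smul_absolutelyContinuous⟩
  exact hq.ae_eq_comp h

theorem fourier_comp_mul_left {a : ℝ} (ha : a ≠ 0) (ψ : ℝ → ℂ) (y : ℝ) :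
    𝓕 (fun x => ψ (a * x)) y = |a⁻¹| • 𝓕 ψ (a⁻¹ * y) := by
  rw [Real.fourier_real_eq, Real.fourier_real_eq,
    ← Measure.integral_comp_mul_left (fun v => Real.fourierChar (-(v * (a⁻¹ * y))) • ψ v) a]
  refine integral_congr_ae (ae_of_all _ fun v => ?_)
  have : a * v * (a⁻¹ * y) = v * y := by field_simp
  simp only [this]

/-- Test against `ψ` and substitute `x ↦ a x` on both sides. The law serves the change of
normalisation (`a = (2π)⁻¹`) and evenness (`a = -1`). -/
theorem fourier_dilate {a : ℝ} (ha : a ≠ 0) (f : LineL2) :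
    (𝓕 (dilate a ha f) : LineL2) = ((|a⁻¹| : ℝ) : ℂ) • dilate a⁻¹ (inv_ne_zero ha) (𝓕 f) := by
  refine Lp.ext ?_
  refine (coeFn_fourier_ae_eq ((Lp.memLp _).locallyIntegrable (by norm_num)) fun ψ => ?_)
  set A : ℝ ≃L[ℝ] ℝ := ContinuousLinearEquiv.unitsEquivAut ℝ (Units.mk0 a ha)
  have hA : ∀ x, A x = a * x := fun x => by simp [A, mul_comm]
  set ψ' : SchwartzMap ℝ ℂ := SchwartzMap.compCLMOfContinuousLinearEquiv ℂ A ψ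
  have hψ' : (ψ' : ℝ → ℂ) = fun x => ψ (a * x) := by
    funext x
    simp [ψ', hA]
  have h1 : ∫ x, ψ x • (((|a⁻¹| : ℝ) : ℂ) • dilate a⁻¹ (inv_ne_zero ha) (𝓕 f) : LineL2) x
      = ∫ x, |a⁻¹| • (ψ (a * (a⁻¹ * x)) • (𝓕 f : LineL2) (a⁻¹ * x)) := by
    refine integral_congr_ae ?_
    filter_upwards [Lp.coeFn_smul ((|a⁻¹| : ℝ) : ℂ) (dilate a⁻¹ (inv_ne_zero ha) (𝓕 f)),
      coeFn_dilate (inv_ne_zero ha) (𝓕 f)] with x hx hx'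
    rw [hx, Pi.smul_apply, hx', mul_inv_cancel_left₀ ha]
    simp only [smul_eq_mul, Complex.real_smul]
    ring
  have h2 : ∫ x, (𝓕 (ψ : ℝ → ℂ)) x • dilate a ha f x
      = ∫ x, (𝓕 (ψ : ℝ → ℂ)) (a⁻¹ * (a * x)) • f (a * x) := by
    refine integral_congr_ae ?_
    filter_upwards [coeFn_dilate ha f] with x hx
    rw [hx, inv_mul_cancel_left₀ ha]
  rw [h1, integral_smul, Measure.integral_comp_mul_left (fun x => ψ (a * x) • (𝓕 f : LineL2) x),
    h2, Measure.integral_comp_mul_left (fun x => (𝓕 (ψ : ℝ → ℂ) : ℝ → ℂ) (a⁻¹ * x) • f x) a]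
  have h3 := integral_smul_fourier_coeFn f ψ'
  rw [hψ'] at h3
  rw [h3]
  simp only [fourier_comp_mul_left ha, smul_assoc]
  rw [integral_smul, inv_inv, ← mul_smul |a⁻¹| |a|, ← abs_mul, inv_mul_cancel₀ ha]
  simp

theorem dilate_smul {a : ℝ} (ha : a ≠ 0) (c : ℂ) (f : LineL2) :
    dilate a ha (c • f) = c • dilate a ha f := by
  refine Lp.ext ?_
  filter_upwards [coeFn_dilate ha (c • f), coeFn_dilate ha f, Lp.coeFn_smul c (dilate a ha f),
    ae_eq_comp_mul_left ha (Lp.coeFn_smul c f)] with x h1 h2 h3 h4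
  rw [h1, h3, h4, Pi.smul_apply, Pi.smul_apply, h2]

theorem dilate_inv_dilate {a : ℝ} (ha : a ≠ 0) (f : LineL2) :
    dilate a ha (dilate a⁻¹ (inv_ne_zero ha) f) = f := by
  refine Lp.ext ?_
  filter_upwards [coeFn_dilate ha (dilate a⁻¹ (inv_ne_zero ha) f),
    ae_eq_comp_mul_left ha (coeFn_dilate (inv_ne_zero ha) f)] with x h1 h2
  rw [h1, h2, inv_mul_cancel_left₀ ha]

theorem fourierInv_dilate {a : ℝ} (ha : a ≠ 0) (f : LineL2) :
    (𝓕⁻ (dilate a ha f) : LineL2) = ((|a⁻¹| : ℝ) : ℂ) • dilate a⁻¹ (inv_ne_zero ha) (𝓕⁻ f) := by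
  have h := fourier_dilate (inv_ne_zero ha) (𝓕⁻ f)
  rw [fourier_fourierInv_eq] at h
  have h' : (𝓕 (((|a⁻¹| : ℝ) : ℂ) • dilate a⁻¹ (inv_ne_zero ha) (𝓕⁻ f)) : LineL2) = dilate a ha f := by
    have h0 : ((|a⁻¹| : ℝ) : ℂ) * ((|a| : ℝ) : ℂ) = 1 := by
      rw [← Complex.ofReal_mul, ← abs_mul, inv_mul_cancel₀ ha]; simp
    rw [FourierTransform.fourier_smul, h, smul_smul]
    simp only [inv_inv, h0, one_smul]
  rw [← h', fourierInv_fourier_eq]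

/-- Integration of `f ∈ L²` against a kernel which is the inverse Fourier transform of `m`. -/
theorem integral_kernel_eq_fourier {m k : ℝ → ℝ} (hm : Integrable m) (hm2 : MemLp m 2 volume)
    (hk : ∀ y, 𝓕⁻ (fun w => (m w : ℂ)) y = k y) (f : LineL2) (x : ℝ) :
    ∫ ξ, k (x - ξ) • f ξ = 𝓕 (fun w => (m w : ℂ) * (𝓕⁻ f : LineL2) w) x := by
  -- Modulating `m` by `e` gives `𝓕 (e m) ξ = k (x - ξ)`. As `k` is real, the integral is the inner
  -- product of `𝓕 (e m)` with `f`, and Plancherel moves it to the frequency side. The identity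
  -- holds at every `x`, not only almost everywhere.
  set e : ℝ → ℂ := fun w => (Real.fourierChar (x * w) : ℂ)
  have he : Continuous e := by
    have := Real.continuous_fourierChar
    exact continuous_subtype_val.comp (this.comp (continuous_const.mul continuous_id))
  set p : ℝ → ℂ := fun w => e w * m w
  have hpe : ∀ w, ‖e w‖ = 1 := fun w => Circle.norm_coe _
  have hp : Integrable p := hm.ofReal.bdd_mul (c := 1) he.aestronglyMeasurable
    (ae_of_all _ fun w => (hpe w).le)
  have hp2 : MemLp p 2 volume := by
    refine MemLp.of_le hm2 (hp.1) (ae_of_all _ fun w => ?_)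
    simp [p, hpe]
  have h1 := Lp.inner_fourier_eq (hp2.toLp p) (𝓕⁻ f)
  rw [fourier_fourierInv_eq, L2.inner_def, L2.inner_def] at h1
  have h2 : ∀ ξ, 𝓕 p ξ = k (x - ξ) := fun ξ => by
    rw [← hk, Real.fourierInv_eq, Real.fourier_real_eq]
    refine integral_congr_ae (ae_of_all _ fun w => ?_)
    simp only [Circle.smul_def, p, e, smul_eq_mul, ← mul_assoc, ← Circle.coe_mul,
      ← AddChar.map_add_eq_mul]
    congr 3
    simp only [RCLike.inner_apply, conj_trivial]
    ring_nf
  calc ∫ ξ, k (x - ξ) • f ξ = _ := by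
        refine integral_congr_ae ?_
        filter_upwards [coeFn_fourier_toLp hp hp2] with ξ hξ
        rw [hξ, h2]
        simp [mul_comm]
    _ = _ := h1
    _ = _ := by
        rw [Real.fourier_real_eq]
        refine integral_congr_ae ?_
        filter_upwards [hp2.coeFn_toLp] with w hw
        rw [hw]
        simp only [p, e, RCLike.inner_apply, map_mul, Complex.conj_ofReal, Circle.smul_def,
          smul_eq_mul, AddChar.map_neg_eq_inv, Circle.coe_inv_eq_conj, mul_comm w x]
        ring

/-! ### Pego's criterion: compactness in `L²(ℝ)` through decay of functions and transforms -/

/-- The tails of the functions in `F` are uniformly small in `L²`. -/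
def UniformlySmallTails (F : Set LineL2) : Prop :=
  ∀ ε > (0 : ℝ), ∃ R : ℝ, 0 < R ∧
    ∀ f ∈ F, eLpNorm f 2 (volume.restrict (Ioo (-R) R)ᶜ) ≤ ENNReal.ofReal ε

theorem isCompact_closure_iff_totallyBounded {α : Type*} [UniformSpace α] [CompleteSpace α]
    {s : Set α} : IsCompact (closure s) ↔ TotallyBounded s :=
  ⟨fun h => h.totallyBounded.subset subset_closure,
    fun h => h.closure.isCompact_of_isClosed isClosed_closure⟩

/-- A finite `η`-net of the image with centres in the image pulls back to an `ε`-net. Since `Φ` may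
depend on `ε` and need not be continuous, finitely many measurements at each scale are enough. -/
theorem Metric.totallyBounded_of_image {α : Type*} [PseudoMetricSpace α] {s : Set α}
    (H : ∀ ε > 0, ∃ (β : Type) (_ : PseudoMetricSpace β) (Φ : α → β), TotallyBounded (Φ '' s) ∧
      ∃ η > 0, ∀ x ∈ s, ∀ y ∈ s, dist (Φ x) (Φ y) < η → dist x y < ε) : TotallyBounded s := by
  rcases s.eq_empty_or_nonempty with rfl | ⟨x₀, -⟩
  · exact totallyBounded_empty
  have : Nonempty α := ⟨x₀⟩
  refine Metric.totallyBounded_iff.2 fun ε hε => ?_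
  obtain ⟨β, _, Φ, hΦ, η, hη, h⟩ := H ε hε
  obtain ⟨t, hts, ht, hcov⟩ := totallyBounded_iff_subset.1 hΦ _ (Metric.dist_mem_uniformity hη)
  choose! g hgs hg using fun y (hy : y ∈ t) => hts hy
  refine ⟨g '' t, ht.image g, fun x hx => ?_⟩
  obtain ⟨y, hy, hxy⟩ := mem_iUnion₂.1 (hcov (mem_image_of_mem Φ hx))
  refine mem_iUnion₂.2 ⟨g y, mem_image_of_mem g hy, h x hx (g y) (hgs y hy) ?_⟩
  rw [hg y hy]
  exact hxy

theorem eLpNorm_le_restrict_add_compl {f : ℝ → ℂ} {s : Set ℝ} (hs : MeasurableSet s)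
    (hf : AEStronglyMeasurable f volume) :
    eLpNorm f 2 volume ≤ eLpNorm f 2 (volume.restrict s) + eLpNorm f 2 (volume.restrict sᶜ) := by
  rw [← eLpNorm_indicator_eq_eLpNorm_restrict hs, ← eLpNorm_indicator_eq_eLpNorm_restrict hs.compl]
  conv_lhs => rw [← indicator_self_add_compl s f]
  exact eLpNorm_add_le (hf.indicator hs) (hf.indicator hs.compl) (by norm_num)

theorem eLpNorm_restrict_antitone {f : ℝ → ℂ} {R S : ℝ} (h : R ≤ S) :
    eLpNorm f 2 (volume.restrict (Ioo (-S) S)ᶜ) ≤ eLpNorm f 2 (volume.restrict (Ioo (-R) R)ᶜ) :=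
  eLpNorm_mono_measure _ (Measure.restrict_mono
    (compl_subset_compl.2 (Ioo_subset_Ioo (neg_le_neg h) h)) le_rfl)

/-- Approximate `f` by a compactly supported `g`; outside the support of `g`, `f` equals `f - g`. -/
theorem exists_eLpNorm_tail_le (f : LineL2) {ε : ℝ} (hε : 0 < ε) :
    ∃ R : ℝ, 0 < R ∧ eLpNorm f 2 (volume.restrict (Ioo (-R) R)ᶜ) ≤ ENNReal.ofReal ε := by
  obtain ⟨g, hgc, hg, -, -⟩ := (Lp.memLp f).exists_hasCompactSupport_eLpNorm_sub_le (by norm_num)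
    (ENNReal.ofReal_pos.2 hε).ne'
  obtain ⟨r, hr⟩ := (Metric.isBounded_iff_subset_ball (0 : ℝ)).1 hgc.isCompact.isBounded
  refine ⟨max r 1, by positivity, ?_⟩
  refine le_trans (le_of_eq (eLpNorm_congr_ae ?_))
    ((eLpNorm_restrict_le _ _ _ (Ioo (-max r 1) (max r 1))ᶜ).trans hg)
  filter_upwards [ae_restrict_mem measurableSet_Ioo.compl] with x hx
  have : x ∉ tsupport g := fun h => by
    have h1 := hr h
    rw [Real.ball_eq_Ioo, zero_sub, zero_add] at h1
    exact hx (Ioo_subset_Ioo (neg_le_neg (le_max_left _ _)) (le_max_left _ _) h1)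
  simp [image_eq_zero_of_notMem_tsupport this]

/-- Take the largest of the radii belonging to a finite `ε/2`-net. -/
theorem TotallyBounded.uniformlySmallTails {F : Set LineL2} (hF : TotallyBounded F) :
    UniformlySmallTails F := by
  intro ε hε
  obtain ⟨t, ht, hcov⟩ := Metric.totallyBounded_iff.1 hF (ε / 2) (half_pos hε)
  choose R hR0 hR using fun f : LineL2 => exists_eLpNorm_tail_le f (half_pos hε)
  obtain ⟨S, hS⟩ := (ht.image R).bddAbove
  refine ⟨max S 1, by positivity, fun f hf => ?_⟩
  obtain ⟨g, hg, hfg⟩ := mem_iUnion₂.1 (hcov hf)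
  set μ := (volume : Measure ℝ).restrict (Ioo (-(max S 1)) (max S 1))ᶜ
  have h1 : eLpNorm (g + (f - g) : LineL2) 2 μ ≤ eLpNorm g 2 μ + eLpNorm (f - g : LineL2) 2 μ := by
    refine le_trans (le_of_eq (eLpNorm_congr_ae (ae_restrict_of_ae (Lp.coeFn_add g (f - g)))))
      (eLpNorm_add_le ?_ ?_ (by norm_num)) <;> exact (Lp.aestronglyMeasurable _).restrict
  rw [add_sub_cancel] at h1
  refine h1.trans ?_
  rw [← add_halves ε, ENNReal.ofReal_add (by positivity) (by positivity)]
  refine add_le_add ((eLpNorm_restrict_antitone ?_).trans (hR g)) ?_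
  · exact (hS (mem_image_of_mem R hg)).trans (le_max_left _ _)
  · refine (eLpNorm_restrict_le _ _ _ _).trans ?_
    rw [← Lp.enorm_def, ← ofReal_norm, ← dist_eq_norm]
    exact ENNReal.ofReal_le_ofReal (Metric.mem_ball.1 hfg).le

theorem integrable_indicator_Ioo (R : ℝ) (f : LineL2) :
    Integrable ((Ioo (-R) R).indicator f) :=
  (integrable_indicator_iff measurableSet_Ioo).2
    (((Lp.memLp f).restrict _).integrable (by norm_num))

theorem exists_integral_norm_indicator_le (R : ℝ) :
    ∃ c : ℝ, 0 ≤ c ∧ ∀ f : LineL2, ∫ x, ‖(Ioo (-R) R).indicator f x‖ ≤ c * ‖f‖ := by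
  set q : ℝ≥0∞ := volume.restrict (Ioo (-R) R) univ ^ ((1 : ℝ≥0∞).toReal⁻¹ - (2 : ℝ≥0∞).toReal⁻¹)
  have hq : q ≠ ∞ := (ENNReal.rpow_lt_top_of_nonneg (by norm_num) (by simp)).ne
  refine ⟨q.toReal, ENNReal.toReal_nonneg, fun f => ?_⟩
  rw [integral_norm_eq_lintegral_enorm (integrable_indicator_Ioo R f).1,
    ← eLpNorm_one_eq_lintegral_enorm, eLpNorm_indicator_eq_eLpNorm_restrict measurableSet_Ioo,
    Lp.norm_def, mul_comm, ← ENNReal.toReal_mul]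
  refine ENNReal.toReal_mono (ENNReal.mul_ne_top (Lp.eLpNorm_ne_top f) hq) ?_
  refine (eLpNorm_le_eLpNorm_mul_rpow_measure_univ (p := 1) (q := 2) (by norm_num)
    (Lp.aestronglyMeasurable f).restrict).trans ?_
  simp only [one_div]
  exact mul_le_mul_left (eLpNorm_restrict_le _ _ _ _) _

/-- The Fourier integral of the restriction of `f ∈ L²(ℝ)` to `(-R, R)`. -/
noncomputable def truncatedFourier (R : ℝ) (f : LineL2) : ℝ → ℂ :=
  𝓕 ((Ioo (-R) R).indicator f)

theorem integrable_fourierChar_smul (w : ℝ) {p : ℝ → ℂ} (hp : Integrable p) :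
    Integrable (fun v => Real.fourierChar (-(v * w)) • p v) := by
  refine hp.norm.mono' ?_ (ae_of_all _ fun v => by simp [Circle.norm_smul])
  have : Continuous fun v : ℝ => (Real.fourierChar (-(v * w)) : ℂ) :=
    continuous_subtype_val.comp (Real.continuous_fourierChar.comp (by fun_prop))
  exact this.aestronglyMeasurable.smul hp.1

theorem truncatedFourier_sub (R : ℝ) (f g : LineL2) (w : ℝ) :
    truncatedFourier R (f - g) w = truncatedFourier R f w - truncatedFourier R g w := by
  simp only [truncatedFourier, Real.fourier_real_eq]
  rw [← integral_sub]
  · refine integral_congr_ae ?_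
    filter_upwards [Lp.coeFn_sub f g] with x hx
    rw [← smul_sub]
    congr 1
    by_cases h : x ∈ Ioo (-R) R
    · simp only [indicator_of_mem h, hx, Pi.sub_apply]
    · simp only [indicator_of_notMem h, sub_zero]
  all_goals exact integrable_fourierChar_smul _ (integrable_indicator_Ioo R _)

theorem norm_truncatedFourier_le (R : ℝ) (f : LineL2) (w : ℝ) :
    ‖truncatedFourier R f w‖ ≤ ∫ x, ‖(Ioo (-R) R).indicator f x‖ := by
  rw [truncatedFourier, Real.fourier_real_eq]
  exact (norm_integral_le_integral_norm _).trans (by simp [Circle.norm_smul])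

theorem norm_fourierChar_sub_le (s t : ℝ) :
    ‖(Real.fourierChar s : ℂ) - Real.fourierChar t‖ ≤ 2 * Real.pi * |s - t| := by
  have h1 : (Real.fourierChar s : ℂ) - Real.fourierChar t
      = Real.fourierChar t * (Complex.exp (Complex.I * (2 * Real.pi * (s - t) : ℝ)) - 1) := by
    rw [mul_sub, mul_one, Real.fourierChar_apply, Real.fourierChar_apply, ← Complex.exp_add]
    congr 2
    push_cast
    ring
  rw [h1, norm_mul, Circle.norm_coe, one_mul]
  refine Real.norm_exp_I_mul_ofReal_sub_one_le.trans (le_of_eq ?_)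
  rw [norm_mul, Real.norm_eq_abs, Real.norm_eq_abs, abs_of_pos (by positivity)]

/-- Truncation to `|x| < R` makes the phase `x v` Lipschitz in `v` with constant `R`, so the
transform can be controlled by sampling it on a finite net. -/
theorem norm_truncatedFourier_sub_le (R : ℝ) (f : LineL2) (v w : ℝ) :
    ‖truncatedFourier R f v - truncatedFourier R f w‖ ≤
      2 * Real.pi * R * |v - w| * ∫ x, ‖(Ioo (-R) R).indicator f x‖ := by
  simp only [truncatedFourier, Real.fourier_real_eq]
  rw [← integral_sub, ← integral_const_mul]
  · refine norm_integral_le_of_norm_le ((integrable_indicator_Ioo R f).norm.const_mul _)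
      (ae_of_all _ fun x => ?_)
    rw [Circle.smul_def, Circle.smul_def, ← sub_smul, norm_smul]
    by_cases h : x ∈ Ioo (-R) R
    · refine mul_le_mul_of_nonneg_right ((norm_fourierChar_sub_le _ _).trans ?_) (norm_nonneg _)
      have hx : |x| ≤ R := (abs_lt.2 h).le
      have : -(x * v) - -(x * w) = -(x * (v - w)) := by ring
      rw [this, abs_neg, abs_mul, ← mul_assoc]
      gcongr
    · simp [indicator_of_notMem h]
  all_goals exact integrable_fourierChar_smul _ (integrable_indicator_Ioo R f)

/-- Measure `u` through `𝓕 u` and cut the frequencies at `R`. Inside, `𝓕 u` is the truncated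
transform, with `L²` norm at most `√(2R) κ` on an interval of length `2R`, plus the transform of the
tail of `u`, handled by Plancherel. -/
theorem enorm_le_of_truncatedFourier_le (u : LineL2) {R κ : ℝ}
    (h : ∀ w ∈ Ioo (-R) R, ‖truncatedFourier R u w‖ ≤ κ) :
    ‖u‖ₑ ≤ eLpNorm u 2 (volume.restrict (Ioo (-R) R)ᶜ)
      + eLpNorm (𝓕 u : LineL2) 2 (volume.restrict (Ioo (-R) R)ᶜ)
      + ENNReal.ofReal (2 * R) ^ (1 / 2 : ℝ) * ENNReal.ofReal κ := by
  set s := Ioo (-R) R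
  have hs : MeasurableSet s := measurableSet_Ioo
  have m1 : MemLp (s.indicator u) 2 volume := (Lp.memLp u).indicator hs
  have m2 : MemLp (sᶜ.indicator u) 2 volume := (Lp.memLp u).indicator hs.compl
  have hu : u = m1.toLp _ + m2.toLp _ := by
    rw [← MemLp.toLp_add]
    refine Lp.ext ((MemLp.coeFn_toLp _).trans ?_).symm
    rw [indicator_self_add_compl]
  have e1 : ‖u‖ₑ = ‖(𝓕 u : LineL2)‖ₑ := by
    rw [← ofReal_norm, ← ofReal_norm, Lp.norm_fourier_eq]
  have e2 : eLpNorm (𝓕 u : LineL2) 2 (volume.restrict s)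
      ≤ ENNReal.ofReal (2 * R) ^ (1 / 2 : ℝ) * ENNReal.ofReal κ
        + eLpNorm u 2 (volume.restrict sᶜ) := by
    have e3 : (𝓕 u : LineL2) =ᵐ[volume.restrict s]
        truncatedFourier R u + (𝓕 (m2.toLp _) : LineL2) := by
      have : (𝓕 u : LineL2) = 𝓕 (m1.toLp _) + 𝓕 (m2.toLp _) := by
        rw [← FourierTransform.fourier_add, ← hu]
      rw [this]
      refine ae_restrict_of_ae ?_
      filter_upwards [Lp.coeFn_add (𝓕 (m1.toLp _) : LineL2) (𝓕 (m2.toLp _)),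
        coeFn_fourier_toLp (integrable_indicator_Ioo R u) m1] with x hx hx'
      rw [hx, Pi.add_apply, Pi.add_apply, hx']
      rfl
    rw [eLpNorm_congr_ae e3]
    refine (eLpNorm_add_le ?_ (Lp.aestronglyMeasurable _).restrict (by norm_num)).trans
      (add_le_add ?_ ?_)
    · exact (continuous_fourier_of_integrable
        (integrable_indicator_Ioo R u)).aestronglyMeasurable
    · refine (eLpNorm_le_of_ae_bound (C := κ) ?_).trans (le_of_eq ?_)
      · filter_upwards [ae_restrict_mem hs] with w hw using h w hw
      · simp [s, two_mul]
    · refine (eLpNorm_restrict_le _ _ _ _).trans (le_of_eq ?_)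
      rw [← Lp.enorm_def, ← ofReal_norm, Lp.norm_fourier_eq, ofReal_norm,
        Lp.enorm_def, eLpNorm_congr_ae m2.coeFn_toLp,
        eLpNorm_indicator_eq_eLpNorm_restrict hs.compl]
  rw [e1, Lp.enorm_def]
  refine (eLpNorm_le_restrict_add_compl hs (Lp.aestronglyMeasurable _)).trans ?_
  refine (add_le_add e2 le_rfl).trans (le_of_eq ?_)
  ring

theorem eLpNorm_sub_tail_le {f g : LineL2} {R ε : ℝ} (hε : 0 ≤ ε)
    (hf : eLpNorm f 2 (volume.restrict (Ioo (-R) R)ᶜ) ≤ ENNReal.ofReal ε)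
    (hg : eLpNorm g 2 (volume.restrict (Ioo (-R) R)ᶜ) ≤ ENNReal.ofReal ε) :
    eLpNorm (f - g : LineL2) 2 (volume.restrict (Ioo (-R) R)ᶜ) ≤ ENNReal.ofReal (2 * ε) := by
  rw [eLpNorm_congr_ae (ae_restrict_of_ae (Lp.coeFn_sub f g)), two_mul,
    ENNReal.ofReal_add hε hε]
  exact (eLpNorm_sub_le (Lp.aestronglyMeasurable _).restrict
    (Lp.aestronglyMeasurable _).restrict (by norm_num)).trans (add_le_add hf hg)

/-- **Pego's theorem**: a bounded subset of `L²(ℝ)` with uniformly small tails whose Fourier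
transforms have uniformly small tails is totally bounded. -/
theorem totallyBounded_of_uniformlySmallTails {K : Set LineL2} (hK : Bornology.IsBounded K)
    (h1 : UniformlySmallTails K)
    (h2 : UniformlySmallTails ((fun f : LineL2 => (𝓕 f : LineL2)) '' K)) : TotallyBounded K := by
  obtain ⟨C, hC0, hC⟩ : ∃ C : ℝ, 0 < C ∧ ∀ f ∈ K, ‖f‖ ≤ C := by
    obtain ⟨C, hC⟩ := hK.exists_norm_le
    exact ⟨max C 1, by positivity, fun f hf => (hC f hf).trans (le_max_left _ _)⟩
  -- Error budget for a difference `f - g`: `2 · ε/8` for each of the two tails and `ε/8` for the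
  -- truncated transform, in total `5ε/8`.
  refine Metric.totallyBounded_of_image fun ε hε => ?_
  obtain ⟨R₁, -, hR₁⟩ := h1 (ε / 8) (by positivity)
  obtain ⟨R₂, hR₂0, hR₂⟩ := h2 (ε / 8) (by positivity)
  set R := max R₁ R₂
  have hR : 0 < R := lt_max_of_lt_right hR₂0
  obtain ⟨c, hc0, hc⟩ := exists_integral_norm_indicator_le R
  set q : ℝ := (2 * R) ^ (1 / 2 : ℝ)
  have hq : 0 ≤ q := by positivity
  set κ : ℝ := ε / (8 * (q + 1))
  have hκ : 0 < κ := by positivity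
  have hqκ : q * κ ≤ ε / 8 := by
    simp only [κ]
    rw [mul_div_assoc', div_le_div_iff₀ (by positivity) (by positivity)]
    nlinarith
  -- A Lipschitz constant for the truncated transform of `f - g`, using `‖f - g‖ ≤ 2C`; the `+ 1`
  -- keeps it positive. A net of mesh `κ/2/D` then costs at most `κ/2` between nodes.
  set D : ℝ := 2 * Real.pi * R * (c * (2 * C) + 1)
  have hD : 0 < D := by positivity
  obtain ⟨t, ht, hcov⟩ := Metric.totallyBounded_iff.1
    (isCompact_Icc (a := -R) (b := R)).totallyBounded (κ / 2 / D) (by positivity)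
  have := ht.fintype
  -- The measurements are the values of the truncated transform at the nodes; on `K` they stay in a
  -- closed ball of a finite-dimensional space.
  refine ⟨t → ℂ, inferInstance, fun f (w : t) => truncatedFourier R f w, ?_, κ / 2,
    by positivity, fun f hf g hg h => ?_⟩
  · refine (isCompact_closedBall (0 : t → ℂ) (c * C)).totallyBounded.subset ?_
    rintro _ ⟨f, hf, rfl⟩
    rw [mem_closedBall_zero_iff, pi_norm_le_iff_of_nonneg (by positivity)]
    exact fun w => (norm_truncatedFourier_le R f w).trans
      ((hc f).trans (mul_le_mul_of_nonneg_left (hC f hf) hc0))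
  have hu : ‖f - g‖ ≤ 2 * C := (norm_sub_le f g).trans (by linarith [hC f hf, hC g hg])
  have hN := (hc (f - g)).trans (mul_le_mul_of_nonneg_left hu hc0)
  have hκ' : ∀ w ∈ Ioo (-R) R, ‖truncatedFourier R (f - g) w‖ ≤ κ := by
    intro w hw
    obtain ⟨v, hv, hwv⟩ := mem_iUnion₂.1 (hcov (Ioo_subset_Icc_self hw))
    have e1 : ‖truncatedFourier R (f - g) v‖ ≤ κ / 2 := by
      rw [truncatedFourier_sub, ← dist_eq_norm]
      exact ((dist_le_pi_dist (fun w : t => truncatedFourier R f w)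
        (fun w : t => truncatedFourier R g w) ⟨v, hv⟩).trans_lt h).le
    have e2 : ‖truncatedFourier R (f - g) w - truncatedFourier R (f - g) v‖ ≤ κ / 2 := by
      refine (norm_truncatedFourier_sub_le R _ _ _).trans ?_
      have hwv' : |w - v| ≤ κ / 2 / D := (Metric.mem_ball.1 hwv).le
      calc _ ≤ 2 * Real.pi * R * (κ / 2 / D) * (c * (2 * C) + 1) := by
            gcongr
            linarith
        _ = κ / 2 := by
            simp only [D]
            field_simp
    have e3 := norm_le_norm_sub_add (truncatedFourier R (f - g) w) (truncatedFourier R (f - g) v)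
    linarith
  have key := enorm_le_of_truncatedFourier_le (f - g) hκ'
  have hF : (𝓕 (f - g) : LineL2) = 𝓕 f - 𝓕 g := (Lp.fourierTransformₗᵢ ℝ ℂ).map_sub f g
  rw [hF] at key
  have t1 := fun f (hf : f ∈ K) => (eLpNorm_restrict_antitone (le_max_left R₁ R₂)).trans (hR₁ f hf)
  have t2 := fun f (hf : f ∈ K) => (eLpNorm_restrict_antitone (le_max_right R₁ R₂)).trans
    (hR₂ _ (mem_image_of_mem _ hf))
  have key2 : ‖f - g‖ₑ ≤ ENNReal.ofReal (2 * (ε / 8) + 2 * (ε / 8) + q * κ) := by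
    refine key.trans ?_
    rw [ENNReal.ofReal_add (by positivity) (by positivity),
      ENNReal.ofReal_add (by positivity) (by positivity), ENNReal.ofReal_mul hq,
      ← ENNReal.ofReal_rpow_of_nonneg (by positivity) (by positivity)]
    exact add_le_add (add_le_add (eLpNorm_sub_tail_le (by positivity) (t1 f hf) (t1 g hg))
      (eLpNorm_sub_tail_le (by positivity) (t2 f hf) (t2 g hg))) le_rfl
  rw [← ofReal_norm, ENNReal.ofReal_le_ofReal_iff (by positivity)] at key2
  rw [dist_eq_norm]
  linarith

theorem Bornology.IsBounded.image_fourierInv {K : Set LineL2} (hK : Bornology.IsBounded K) :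
    Bornology.IsBounded ((fun f : LineL2 => (𝓕⁻ f : LineL2)) '' K) :=
  (Lp.fourierTransformₗᵢ ℝ ℂ).symm.lipschitz.isBounded_image hK

/-- Compactness in `L²(ℝ)` is uniform decay of the functions and of their Fourier transforms. -/
theorem isCompact_closure_iff_uniformlySmallTails {K : Set LineL2} (hK : Bornology.IsBounded K) :
    IsCompact (closure K) ↔ UniformlySmallTails ((fun f : LineL2 => (𝓕⁻ f : LineL2)) '' K) ∧
      UniformlySmallTails K := by
  rw [isCompact_closure_iff_totallyBounded]
  set U := Lp.fourierTransformₗᵢ ℝ ℂ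
  have hU : ((fun f : LineL2 => (𝓕⁻ f : LineL2)) '' K) = U.symm '' K := rfl
  refine ⟨fun h => ⟨?_, h.uniformlySmallTails⟩, fun ⟨h1, h2⟩ => ?_⟩
  · rw [hU]
    exact (h.image U.symm.lipschitz.uniformContinuous).uniformlySmallTails
  -- Pego's theorem is applied to `𝓕⁻ K`, whose transforms form `K`; the result is carried back by
  -- the isometry `𝓕`.
  · have h3 : (fun f : LineL2 => (𝓕 f : LineL2)) '' ((fun f : LineL2 => (𝓕⁻ f : LineL2)) '' K)
        = K := by
      rw [image_image]
      simp only [fourier_fourierInv_eq, image_id']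
    have h4 := (totallyBounded_of_uniformlySmallTails hK.image_fourierInv h1 (by rwa [h3])).image
      U.lipschitz.uniformContinuous
    rwa [← h3]

/-! ### Translations given by Fourier multipliers -/

/-- `T` acts on `L²(ℝ)` for `t > 0` as the Fourier multiplier `exp (-t φ)`, where the continuous
symbol `φ ≥ 0` grows at least linearly. -/
structure IsMultiplierTranslation (T : ℝ → (ℝ → ℂ) → ℝ → ℂ) (φ : ℝ → ℝ) : Prop where
  zero_apply : ∀ f, T 0 f = f
  congr_ae : ∀ t > 0, ∀ f g : ℝ → ℂ, f =ᵐ[volume] g → T t f = T t g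
  apply_eq : ∀ t > 0, ∀ (f : LineL2) (x : ℝ),
    T t f x = 𝓕 (fun w => (Real.exp (-(t * φ w)) : ℂ) * (𝓕⁻ f : LineL2) w) x
  continuous : Continuous φ
  nonneg : ∀ w, 0 ≤ φ w
  growth : ∃ c > 0, ∀ w, 1 ≤ |w| → c * |w| ≤ φ w

/-- The factor `1 + w²` is at most `2` for `|w| < 1` and at most `2w²` otherwise, whence the
dominating function `2 max C D / (1 + w²)`. -/
theorem integrable_of_le_inv_one_add_sq {m : ℝ → ℝ} (hm : AEStronglyMeasurable m volume) {C D : ℝ}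
    (h0 : ∀ w, 0 ≤ m w) (h1 : ∀ w, |w| < 1 → m w ≤ C) (h2 : ∀ w, 1 ≤ |w| → m w * w ^ 2 ≤ D) :
    Integrable m := by
  refine (integrable_inv_one_add_sq.const_mul (2 * max C D)).mono' hm (ae_of_all _ fun w => ?_)
  rw [Real.norm_of_nonneg (h0 w), ← div_eq_mul_inv, le_div_iff₀ (by positivity)]
  rcases lt_or_ge |w| 1 with h | h
  · have := (sq_lt_one_iff_abs_lt_one w).2 h
    nlinarith [h1 w h, le_max_left C D, h0 w]
  · have := (one_le_sq_iff_one_le_abs w).2 h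
    nlinarith [h2 w h, le_max_right C D, h0 w]

theorem integrable_exp_neg_mul {φ : ℝ → ℝ} (hφ : Continuous φ) (h0 : ∀ w, 0 ≤ φ w)
    (hg : ∃ c > 0, ∀ w, 1 ≤ |w| → c * |w| ≤ φ w) {s : ℝ} (hs : 0 < s) :
    Integrable fun w => Real.exp (-(s * φ w)) := by
  obtain ⟨c, hc, hcφ⟩ := hg
  -- `D` comes from `x²/2 ≤ exp x` at `x = s c |w|`.
  refine integrable_of_le_inv_one_add_sq (C := 1) (D := 2 / (s * c) ^ 2)
    (by fun_prop : Continuous _).aestronglyMeasurable (fun w => (Real.exp_pos _).le)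
    (fun w _ => Real.exp_le_one_iff.2 (neg_nonpos.2 (mul_nonneg hs.le (h0 w)))) fun w hw => ?_
  have h1 : s * c * |w| ≤ s * φ w := by
    rw [mul_assoc]
    exact mul_le_mul_of_nonneg_left (hcφ w hw) hs.le
  have h2 := Real.quadratic_le_exp_of_nonneg (x := s * c * |w|) (by positivity)
  have h3 := Real.exp_le_exp.2 h1
  rw [Real.exp_neg, le_div_iff₀ (by positivity), inv_mul_eq_div, div_mul_eq_mul_div,
    div_le_iff₀ (Real.exp_pos _), ← sq_abs w]
  have h4 : 0 ≤ s * c * |w| := by positivity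
  nlinarith

theorem memLp_exp_neg_mul {φ : ℝ → ℝ} (hφ : Continuous φ) (h0 : ∀ w, 0 ≤ φ w)
    (hg : ∃ c > 0, ∀ w, 1 ≤ |w| → c * |w| ≤ φ w) {s : ℝ} (hs : 0 < s) :
    MemLp (fun w => Real.exp (-(s * φ w))) 2 volume := by
  refine (memLp_two_iff_integrable_sq (by fun_prop : Continuous _).aestronglyMeasurable).2 ?_
  refine (integrable_exp_neg_mul hφ h0 hg (s := 2 * s) (by positivity)).congr
    (ae_of_all _ fun w => ?_)
  simp only [← Real.exp_nat_mul]
  congr 1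
  push_cast
  ring

theorem abs_exp_neg_sub_exp_neg_le_one {a b : ℝ} (ha : 0 ≤ a) (hb : 0 ≤ b) :
    |Real.exp (-a) - Real.exp (-b)| ≤ 1 := by
  have h1 := Real.exp_le_one_iff.2 (neg_nonpos.2 ha)
  have h2 := Real.exp_le_one_iff.2 (neg_nonpos.2 hb)
  rw [abs_le]
  constructor <;> linarith [Real.exp_pos (-a), Real.exp_pos (-b)]

theorem abs_exp_neg_sub_exp_neg_le {a b : ℝ} (ha : 0 ≤ a) (hb : 0 ≤ b) :
    |Real.exp (-a) - Real.exp (-b)| ≤ |a - b| := by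
  wlog h : a ≤ b generalizing a b
  · rw [abs_sub_comm, abs_sub_comm a]
    exact this hb ha (le_of_not_ge h)
  have h1 : Real.exp (-b) = Real.exp (-a) * Real.exp (-(b - a)) := by
    rw [← Real.exp_add]
    ring_nf
  have h2 := Real.add_one_le_exp (-(b - a))
  have h3 := Real.exp_le_one_iff.2 (neg_nonpos.2 ha)
  have h4 := Real.exp_le_one_iff.2 (neg_nonpos.2 (sub_nonneg.2 h))
  have h5 := Real.exp_pos (-a)
  rw [abs_sub_comm a, abs_of_nonneg (sub_nonneg.2 h), h1, abs_of_nonneg (by nlinarith)]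
  nlinarith

namespace IsMultiplierTranslation

variable {T : ℝ → (ℝ → ℂ) → ℝ → ℂ} {φ : ℝ → ℝ}

theorem memLp_exp_mul (hT : IsMultiplierTranslation T φ) {t : ℝ} (ht : 0 ≤ t) (g : LineL2) :
    MemLp (fun w => (Real.exp (-(t * φ w)) : ℂ) * g w) 2 volume := by
  have := hT.continuous
  refine (Lp.memLp g).of_le ((by fun_prop : Continuous fun w =>
    (Real.exp (-(t * φ w)) : ℂ)).aestronglyMeasurable.mul (Lp.aestronglyMeasurable g))
    (ae_of_all _ fun w => ?_)
  rw [norm_mul, Complex.norm_real, Real.norm_of_nonneg (Real.exp_pos _).le]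
  exact mul_le_of_le_one_left (norm_nonneg _)
    (Real.exp_le_one_iff.2 (neg_nonpos.2 (mul_nonneg ht (hT.nonneg w))))

theorem ae_eq_fourier (hT : IsMultiplierTranslation T φ) {t : ℝ} (ht : 0 ≤ t) (f : LineL2) :
    T t f =ᵐ[volume] (𝓕 ((hT.memLp_exp_mul ht (𝓕⁻ f)).toLp _) : LineL2) := by
  rcases ht.eq_or_lt with rfl | ht'
  · have h : (hT.memLp_exp_mul le_rfl (𝓕⁻ f)).toLp _ = (𝓕⁻ f : LineL2) := by
      refine Lp.ext ((MemLp.coeFn_toLp _).trans (ae_of_all _ fun w => by simp))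
    rw [hT.zero_apply, h, fourier_fourierInv_eq]
  · have hi : Integrable (fun w => (Real.exp (-(t * φ w)) : ℂ) * (𝓕⁻ f : LineL2) w) :=
      (memLp_exp_neg_mul hT.continuous hT.nonneg hT.growth ht').ofReal.integrable_mul
        (Lp.memLp (𝓕⁻ f : LineL2))
    filter_upwards [coeFn_fourier_toLp hi (hT.memLp_exp_mul ht (𝓕⁻ f))] with x hx
    rw [hx, hT.apply_eq t ht']

/-- Plancherel; both directions of the tail criterion are read off from this identity. -/
theorem eLpNorm_sub_eq (hT : IsMultiplierTranslation T φ) {s t : ℝ} (hs : 0 ≤ s) (ht : 0 ≤ t)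
    (f : LineL2) : eLpNorm (fun x => T s f x - T t f x) 2 volume =
      eLpNorm (fun w => ((Real.exp (-(s * φ w)) - Real.exp (-(t * φ w)) : ℝ) : ℂ) *
        (𝓕⁻ f : LineL2) w) 2 volume := by
  set u := (hT.memLp_exp_mul hs (𝓕⁻ f)).toLp _
  set v := (hT.memLp_exp_mul ht (𝓕⁻ f)).toLp _
  have h1 : (fun x => T s f x - T t f x) =ᵐ[volume] (𝓕 (u - v) : LineL2) := by
    have : (𝓕 (u - v) : LineL2) = 𝓕 u - 𝓕 v := (Lp.fourierTransformₗᵢ ℝ ℂ).map_sub u v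
    rw [this]
    filter_upwards [hT.ae_eq_fourier hs f, hT.ae_eq_fourier ht f,
      Lp.coeFn_sub (𝓕 u : LineL2) (𝓕 v)] with x h1 h2 h3
    rw [h1, h2, h3, Pi.sub_apply]
  rw [eLpNorm_congr_ae h1, ← Lp.enorm_def, ← ofReal_norm, Lp.norm_fourier_eq, ofReal_norm,
    Lp.enorm_def]
  refine eLpNorm_congr_ae ?_
  filter_upwards [Lp.coeFn_sub u v, (hT.memLp_exp_mul hs (𝓕⁻ f)).coeFn_toLp,
    (hT.memLp_exp_mul ht (𝓕⁻ f)).coeFn_toLp] with w h1 h2 h3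
  rw [h1, Pi.sub_apply, h2, h3, Complex.ofReal_sub, sub_mul]

/-- One increment suffices, from time `0` to time `δ`: its multiplier has modulus at least `1/2` at
high frequencies. -/
theorem uniformlySmallTails_of_equicontinuousInTime (hT : IsMultiplierTranslation T φ)
    {F : Set LineL2}
    (h : EquicontinuousInTime T univ (Ici 0) volume 2 ((fun f : LineL2 => (f : ℝ → ℂ)) '' F)) :
    UniformlySmallTails ((fun f : LineL2 => (𝓕⁻ f : LineL2)) '' F) := by
  intro ε hε
  obtain ⟨δ, hδ, H⟩ := h (ε / 2) (half_pos hε) 1 one_pos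
  obtain ⟨c, hc, hcφ⟩ := hT.growth
  -- Beyond this radius the growth bound applies and gives `δ φ w ≥ log 2`, that is `exp (-δ φ w) ≤
  -- 1/2`.
  refine ⟨max 1 (Real.log 2 / (δ * c)), by positivity, ?_⟩
  rintro _ ⟨f, hf, rfl⟩
  have h1 := H 0 (by simp [relBall]) δ (abs_of_pos hδ).le (by simpa using hδ.le) _
    (mem_image_of_mem _ hf)
  rw [Measure.restrict_univ, zero_add, hT.eLpNorm_sub_eq hδ.le le_rfl] at h1
  refine (eLpNorm_le_mul_eLpNorm_of_ae_le_mul (c := 2) (g := fun w =>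
    ((Real.exp (-(δ * φ w)) - Real.exp (-(0 * φ w)) : ℝ) : ℂ) * (𝓕⁻ f : LineL2) w) ?_ 2).trans ?_
  · filter_upwards [ae_restrict_mem measurableSet_Ioo.compl] with w hw
    have hw' : max 1 (Real.log 2 / (δ * c)) ≤ |w| := not_lt.1 fun hlt => hw (abs_lt.1 hlt)
    have h2 : Real.log 2 ≤ δ * φ w := by
      have := hcφ w ((le_max_left _ _).trans hw')
      have h3 := (div_le_iff₀ (by positivity)).1 ((le_max_right _ _).trans hw')
      nlinarith
    have h4 : Real.exp (-(δ * φ w)) ≤ 1 / 2 := by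
      refine (Real.exp_le_exp.2 (neg_le_neg h2)).trans ?_
      rw [Real.exp_neg, Real.exp_log two_pos]
      norm_num
    rw [norm_mul, ← mul_assoc, Complex.norm_real, Real.norm_eq_abs, zero_mul, neg_zero,
      Real.exp_zero]
    refine le_mul_of_one_le_left (norm_nonneg _) ?_
    rw [abs_of_nonpos (by linarith)]
    linarith
  · calc _ ≤ ENNReal.ofReal 2 * ENNReal.ofReal (ε / 2) :=
          mul_le_mul_right ((eLpNorm_restrict_le _ _ _ _).trans h1.le) _
      _ = _ := by
          rw [← ENNReal.ofReal_mul two_pos.le]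
          congr 1
          ring

/-- At frequencies below `R` the multiplier increment is at most `|h| φ`; above `R` it is at most
`1` and the tail is small. -/
theorem equicontinuousInTime_of_uniformlySmallTails (hT : IsMultiplierTranslation T φ)
    {F : Set LineL2} (hF : Bornology.IsBounded F)
    (h : UniformlySmallTails ((fun f : LineL2 => (𝓕⁻ f : LineL2)) '' F)) :
    EquicontinuousInTime T univ (Ici 0) volume 2 ((fun f : LineL2 => (f : ℝ → ℂ)) '' F) := by
  intro ε hε M₀ _
  obtain ⟨C, hC0, hC⟩ : ∃ C : ℝ, 0 < C ∧ ∀ f ∈ F, ‖f‖ ≤ C := by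
    obtain ⟨C, hC⟩ := hF.exists_norm_le
    exact ⟨max C 1, by positivity, fun f hf => (hC f hf).trans (le_max_left _ _)⟩
  obtain ⟨R, hR, hRF⟩ := h (ε / 4) (by positivity)
  obtain ⟨B, hB0, hB⟩ : ∃ B : ℝ, 0 < B ∧ ∀ w ∈ Ioo (-R) R, φ w ≤ B := by
    obtain ⟨B, hB⟩ := (isCompact_Icc (a := -R) (b := R)).bddAbove_image hT.continuous.continuousOn
    exact ⟨max B 1, by positivity, fun w hw =>
      (hB (mem_image_of_mem φ (Ioo_subset_Icc_self hw))).trans (le_max_left _ _)⟩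
  -- With `φ ≤ B` on `(-R, R)` and norms at most `C`, the low frequencies contribute at most `ε/4`,
  -- as does the tail.
  refine ⟨ε / (4 * B * C), by positivity, ?_⟩
  rintro t ht δ hδ htδ _ ⟨f, hf, rfl⟩
  have ht0 : 0 ≤ t := ht.1
  have htδ0 : 0 ≤ t + δ := htδ
  rw [Measure.restrict_univ, hT.eLpNorm_sub_eq htδ0 ht0]
  have hmeas : AEStronglyMeasurable (fun w => ((Real.exp (-((t + δ) * φ w))
      - Real.exp (-(t * φ w)) : ℝ) : ℂ) * (𝓕⁻ f : LineL2) w) volume := by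
    have := hT.continuous
    exact (by fun_prop : Continuous fun w => ((Real.exp (-((t + δ) * φ w))
      - Real.exp (-(t * φ w)) : ℝ) : ℂ)).aestronglyMeasurable.mul (Lp.aestronglyMeasurable _)
  have hnn := hT.nonneg
  have h1 := eLpNorm_le_mul_eLpNorm_of_ae_le_mul (μ := volume.restrict (Ioo (-R) R))
    (f := fun w => ((Real.exp (-((t + δ) * φ w)) - Real.exp (-(t * φ w)) : ℝ) : ℂ) *
      (𝓕⁻ f : LineL2) w) (g := (𝓕⁻ f : LineL2)) (c := ε / (4 * C)) (by
        filter_upwards [ae_restrict_mem measurableSet_Ioo] with w hw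
        rw [norm_mul, Complex.norm_real, Real.norm_eq_abs]
        refine mul_le_mul_of_nonneg_right ?_ (norm_nonneg _)
        refine (abs_exp_neg_sub_exp_neg_le (mul_nonneg htδ0 (hnn w))
          (mul_nonneg ht0 (hnn w))).trans ?_
        rw [← sub_mul, add_sub_cancel_left, abs_mul, abs_of_nonneg (hnn w)]
        calc |δ| * φ w ≤ ε / (4 * B * C) * B := by
              gcongr
              · exact hnn w
              · exact hB w hw
          _ = ε / (4 * C) := by field_simp) 2
  have h2 := eLpNorm_le_mul_eLpNorm_of_ae_le_mul (μ := volume.restrict (Ioo (-R) R)ᶜ)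
    (f := fun w => ((Real.exp (-((t + δ) * φ w)) - Real.exp (-(t * φ w)) : ℝ) : ℂ) *
      (𝓕⁻ f : LineL2) w) (g := (𝓕⁻ f : LineL2)) (c := 1) (by
        refine ae_of_all _ fun w => ?_
        rw [norm_mul, Complex.norm_real, Real.norm_eq_abs]
        exact mul_le_mul_of_nonneg_right (abs_exp_neg_sub_exp_neg_le_one
          (mul_nonneg htδ0 (hnn w)) (mul_nonneg ht0 (hnn w))) (norm_nonneg _)) 2
  rw [ENNReal.ofReal_one, one_mul] at h2
  have h3 : eLpNorm (𝓕⁻ f : LineL2) 2 (volume.restrict (Ioo (-R) R)) ≤ ENNReal.ofReal C := by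
    refine (eLpNorm_restrict_le _ _ _ _).trans ?_
    rw [← Lp.enorm_def, ← ofReal_norm]
    exact ENNReal.ofReal_le_ofReal
      (((Lp.fourierTransformₗᵢ ℝ ℂ).symm.norm_map f).trans_le (hC f hf))
  refine (eLpNorm_le_restrict_add_compl measurableSet_Ioo hmeas).trans_lt
    ((add_le_add (h1.trans (mul_le_mul_right h3 _))
      (h2.trans (hRF _ (mem_image_of_mem _ hf)))).trans_lt ?_)
  rw [← ENNReal.ofReal_mul (by positivity), ← ENNReal.ofReal_add (by positivity) (by positivity)]
  refine (ENNReal.ofReal_lt_ofReal_iff hε).2 ?_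
  have : ε / (4 * C) * C = ε / 4 := by field_simp
  linarith

end IsMultiplierTranslation

/-! ### The averages `M_a` as `L²` Fourier multipliers -/

theorem relBall_Ici_zero (a : ℝ) : relBall (Ici 0) a = Ico 0 a := by
  ext t
  simp only [relBall, mem_ofPred_eq, mem_Ici, mem_Ico]
  exact and_congr_right fun h => by rw [abs_of_nonneg h]

/-- The integral of `exp (-t φ)` over `0 ≤ t < a`. -/
noncomputable def integratedSymbol (φ : ℝ → ℝ) (a w : ℝ) : ℝ :=
  ∫ t in Ico 0 a, Real.exp (-(t * φ w))

theorem integratedSymbol_nonneg (φ : ℝ → ℝ) (a w : ℝ) : 0 ≤ integratedSymbol φ a w :=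
  integral_nonneg fun _ => (Real.exp_pos _).le

theorem integrableOn_exp_neg_mul (a s : ℝ) :
    IntegrableOn (fun t : ℝ => Real.exp (-(t * s))) (Ico 0 a) :=
  ((by fun_prop : Continuous fun t : ℝ => Real.exp (-(t * s))).integrableOn_Icc).mono_set
    Ico_subset_Icc_self

theorem integratedSymbol_le {φ : ℝ → ℝ} {a w : ℝ} (ha : 0 ≤ a) (h : 0 ≤ φ w) :
    integratedSymbol φ a w ≤ a := by
  have := setIntegral_mono_on (integrableOn_exp_neg_mul a (φ w))
    (integrableOn_const (C := (1 : ℝ)) (by simp)) measurableSet_Ico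
    fun t ht => Real.exp_le_one_iff.2 (neg_nonpos.2 (mul_nonneg ht.1 h))
  simpa [integratedSymbol, ha] using this

theorem integratedSymbol_mul_le {φ : ℝ → ℝ} {a w : ℝ} (h : 0 < φ w) :
    integratedSymbol φ a w * φ w ≤ 1 := by
  have h1 := integral_exp_mul_Ioi (neg_lt_zero.2 h) 0
  have h2 : integratedSymbol φ a w ≤ ∫ t in Ioi (0 : ℝ), Real.exp (-φ w * t) := by
    rw [integratedSymbol, integral_Ico_eq_integral_Ioo]
    simp only [mul_comm _ (φ w), ← neg_mul]
    exact setIntegral_mono_set (integrableOn_exp_mul_Ioi (neg_lt_zero.2 h) 0)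
      (ae_of_all _ fun t => (Real.exp_pos _).le) Ioo_subset_Ioi_self.eventuallyLE
  rw [h1, mul_zero, Real.exp_zero, neg_div_neg_eq, le_div_iff₀ h] at h2
  exact h2

theorem stronglyMeasurable_integratedSymbol {φ : ℝ → ℝ} (hφ : Continuous φ) (a : ℝ) :
    StronglyMeasurable (integratedSymbol φ a) := by
  refine StronglyMeasurable.integral_prod_right (f := fun w t => Real.exp (-(t * φ w))) ?_
  exact (by fun_prop : Continuous fun p : ℝ × ℝ => Real.exp (-(p.2 * φ p.1))).stronglyMeasurable

/-- The symbol is at most `a`, and at most `1/φ ≤ 1/(c|w|)` for `|w| ≥ 1`. In the Poisson case it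
decays exactly like `1/|w|`, so it is square integrable but not integrable, and the estimates for
`M_a` rest on Cauchy–Schwarz. -/
theorem memLp_integratedSymbol {φ : ℝ → ℝ} (hφ : Continuous φ) (h0 : ∀ w, 0 ≤ φ w)
    (hg : ∃ c > 0, ∀ w, 1 ≤ |w| → c * |w| ≤ φ w) {a : ℝ} (ha : 0 ≤ a) :
    MemLp (integratedSymbol φ a) 2 volume := by
  obtain ⟨c, hc, hcφ⟩ := hg
  have hm := (stronglyMeasurable_integratedSymbol hφ a).aestronglyMeasurable (μ := volume)
  refine (memLp_two_iff_integrable_sq hm).2 ?_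
  refine integrable_of_le_inv_one_add_sq (C := a ^ 2) (D := (1 / c) ^ 2) (hm.pow 2)
    (fun w => sq_nonneg _) (fun w _ => ?_) fun w hw => ?_
  · exact pow_le_pow_left₀ (integratedSymbol_nonneg _ _ _) (integratedSymbol_le ha (h0 w)) 2
  · have h1 := hcφ w hw
    have h2 : 0 < φ w := lt_of_lt_of_le (by positivity) h1
    have h3 := integratedSymbol_mul_le (a := a) h2
    have h4 := integratedSymbol_nonneg φ a w
    rw [← sq_abs w, ← mul_pow]
    refine pow_le_pow_left₀ (by positivity) ?_ 2
    rw [le_div_iff₀ hc]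
    nlinarith

theorem integral_mul_le_sqrt_mul_norm {p : ℝ → ℝ} (hp0 : ∀ x, 0 ≤ p x) (hp : MemLp p 2 volume)
    (g : LineL2) : ∫ x, p x * ‖g x‖ ≤ √(∫ x, p x ^ 2) * ‖g‖ := by
  have h := integral_mul_le_Lp_mul_Lq_of_nonneg (μ := volume) Real.HolderConjugate.two_two
    (f := p) (g := fun x => ‖g x‖) (ae_of_all _ hp0) (ae_of_all _ fun x => norm_nonneg _)
    (by simpa using hp) (by simpa using (Lp.memLp g).norm)
  refine h.trans (le_of_eq ?_)
  simp only [Real.rpow_two, ← Real.sqrt_eq_rpow]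
  congr 1
  have h1 : ‖g‖ ^ 2 = ∫ x, ‖g x‖ ^ 2 := by
    rw [← inner_self_eq_norm_sq (𝕜 := ℂ), L2.inner_def]
    have : ∀ x, inner ℂ (g x) (g x) = ((‖g x‖ ^ 2 : ℝ) : ℂ) := fun x => by
      rw [inner_self_eq_norm_sq_to_K]
      norm_cast
    simp only [this]
    rw [integral_complex_ofReal]
    rfl
  rw [← h1, Real.sqrt_sq (norm_nonneg _)]

/-- Dominated convergence with bound `4 m²`. The function vanishes at `h = 0`, so it provides the
modulus of continuity of the averages. -/
theorem continuous_integral_norm_fourierChar_sub_sq {m : ℝ → ℝ} (hm : MemLp m 2 volume) :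
    Continuous fun h : ℝ => ∫ w, (‖(Real.fourierChar (-(w * h)) : ℂ) - 1‖ * m w) ^ 2 := by
  have hc : Continuous fun s : ℝ => (Real.fourierChar s : ℂ) :=
    continuous_subtype_val.comp Real.continuous_fourierChar
  have hsq : Integrable fun w => m w ^ 2 := (memLp_two_iff_integrable_sq hm.1).1 hm
  refine continuous_of_dominated (bound := fun w => 4 * m w ^ 2) (fun h => ?_) (fun h => ?_)
    (hsq.const_mul 4) (ae_of_all _ fun w => by fun_prop)
  · exact ((by fun_prop : Continuous fun w : ℝ =>
      ‖(Real.fourierChar (-(w * h)) : ℂ) - 1‖).aestronglyMeasurable.mul hm.1).pow 2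
  · refine ae_of_all _ fun w => ?_
    rw [Real.norm_of_nonneg (sq_nonneg _), mul_pow]
    refine mul_le_mul_of_nonneg_right ?_ (sq_nonneg _)
    have := norm_sub_le (Real.fourierChar (-(w * h)) : ℂ) 1
    rw [Circle.norm_coe, norm_one] at this
    nlinarith [norm_nonneg ((Real.fourierChar (-(w * h)) : ℂ) - 1)]

/-- Cauchy–Schwarz separates the shift `h` from `g`; the bound does not depend on `x`. -/
theorem norm_fourier_mul_sub_le {m : ℝ → ℝ} (hm0 : ∀ w, 0 ≤ m w) (hm : MemLp m 2 volume)
    (g : LineL2) (x h : ℝ) :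
    ‖𝓕 (fun w => (m w : ℂ) * g w) (x + h) - 𝓕 (fun w => (m w : ℂ) * g w) x‖ ≤
      √(∫ w, (‖(Real.fourierChar (-(w * h)) : ℂ) - 1‖ * m w) ^ 2) * ‖g‖ := by
  have hi : Integrable fun w => (m w : ℂ) * g w := hm.ofReal.integrable_mul (Lp.memLp g)
  have hc : Continuous fun s : ℝ => (Real.fourierChar s : ℂ) :=
    continuous_subtype_val.comp Real.continuous_fourierChar
  have hp : MemLp (fun w => ‖(Real.fourierChar (-(w * h)) : ℂ) - 1‖ * m w) 2 volume := by
    refine (hm.const_mul 2).of_le ((by fun_prop : Continuous fun w : ℝ =>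
      ‖(Real.fourierChar (-(w * h)) : ℂ) - 1‖).aestronglyMeasurable.mul hm.1)
      (ae_of_all _ fun w => ?_)
    rw [norm_mul, norm_mul, norm_norm, Real.norm_two]
    refine mul_le_mul_of_nonneg_right ?_ (norm_nonneg _)
    have := norm_sub_le (Real.fourierChar (-(w * h)) : ℂ) 1
    rw [Circle.norm_coe, norm_one] at this
    linarith
  refine le_trans ?_ (integral_mul_le_sqrt_mul_norm
    (fun w => mul_nonneg (norm_nonneg _) (hm0 w)) hp g)
  rw [Real.fourier_real_eq, Real.fourier_real_eq, ← integral_sub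
    (integrable_fourierChar_smul _ hi) (integrable_fourierChar_smul _ hi)]
  refine norm_integral_le_of_norm_le (hp.integrable_mul (Lp.memLp g).norm)
    (ae_of_all _ fun w => le_of_eq ?_)
  have e : (Real.fourierChar (-(w * (x + h))) : ℂ)
      = Real.fourierChar (-(w * x)) * Real.fourierChar (-(w * h)) := by
    rw [← Circle.coe_mul, ← AddChar.map_add_eq_mul]
    ring_nf
  rw [Circle.smul_def, Circle.smul_def, ← sub_smul, norm_smul, e, ← mul_sub_one, norm_mul,
    Circle.norm_coe, one_mul, norm_mul, Complex.norm_real, Real.norm_of_nonneg (hm0 w)]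
  exact (mul_assoc _ _ _).symm

namespace IsMultiplierTranslation

variable {T : ℝ → (ℝ → ℂ) → ℝ → ℂ} {φ : ℝ → ℝ}

theorem translateAverage_eq (hT : IsMultiplierTranslation T φ) {a : ℝ} (ha : 0 < a) (f : LineL2)
    (x : ℝ) : translateAverage T (Ici 0) volume a f x =
      a⁻¹ • 𝓕 (fun w => (integratedSymbol φ a w : ℂ) * (𝓕⁻ f : LineL2) w) x := by
  set g : LineL2 := 𝓕⁻ f
  have hφ := hT.continuous
  have hc : Continuous fun s : ℝ => (Real.fourierChar s : ℂ) :=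
    continuous_subtype_val.comp Real.continuous_fourierChar
  have hprod : Integrable (Function.uncurry fun t w : ℝ =>
      Real.fourierChar (-(w * x)) • ((Real.exp (-(t * φ w)) : ℂ) * g w))
      ((volume.restrict (Ico 0 a)).prod volume) := by
    refine (integrable_prod_iff' ?_).2 ⟨ae_of_all _ fun w => ?_, ?_⟩
    · exact (by fun_prop : Continuous fun p : ℝ × ℝ =>
        (Real.fourierChar (-(p.2 * x)) : ℂ)).aestronglyMeasurable.smul
        ((by fun_prop : Continuous fun p : ℝ × ℝ =>
          (Real.exp (-(p.1 * φ p.2)) : ℂ)).aestronglyMeasurable.mul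
          (Lp.aestronglyMeasurable g).comp_snd)
    · simp only [Function.uncurry, Circle.smul_def, smul_eq_mul]
      exact (((integrableOn_exp_neg_mul a (φ w)).ofReal).mul_const _).const_mul _
    -- Integrating the norm over `t` first leaves the integrated symbol times `‖g‖`, a product of
    -- two `L²` functions; this justifies Fubini.
    · refine ((memLp_integratedSymbol hφ hT.nonneg hT.growth ha.le).integrable_mul
        (Lp.memLp g).norm).congr (ae_of_all _ fun w => ?_)
      simp only [Function.uncurry, Circle.norm_smul, norm_mul, Complex.norm_real, Pi.mul_apply,
        Real.norm_of_nonneg (Real.exp_pos _).le]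
      rw [integral_mul_const]
      rfl
  have h1 : ∫ t in Ico 0 a, T t f x = ∫ t in Ico 0 a, ∫ w,
      Real.fourierChar (-(w * x)) • ((Real.exp (-(t * φ w)) : ℂ) * g w) := by
    -- The pointwise multiplier formula is available only for `t > 0`, so the null endpoint `t = 0`
    -- is dropped.
    rw [integral_Ico_eq_integral_Ioo, integral_Ico_eq_integral_Ioo]
    refine setIntegral_congr_fun measurableSet_Ioo fun t ht => ?_
    rw [hT.apply_eq t ht.1, Real.fourier_real_eq]
  rw [translateAverage, relBall_Ici_zero, Real.volume_real_Ico, sub_zero, max_eq_left ha.le, h1,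
    integral_integral_swap hprod, Real.fourier_real_eq]
  congr 1
  refine integral_congr_ae (ae_of_all _ fun w => ?_)
  simp only [Circle.smul_def, smul_eq_mul]
  rw [integral_const_mul, integral_mul_const, integratedSymbol, integral_complex_ofReal]

theorem equicontinuousAverages (hT : IsMultiplierTranslation T φ) {F : Set LineL2}
    (hF : Bornology.IsBounded F) :
    EquicontinuousAverages T univ (Ici 0) volume ((fun f : LineL2 => (f : ℝ → ℂ)) '' F) := by
  intro ε hε a ha R _
  obtain ⟨C, hC⟩ := hF.exists_norm_le
  have hm := memLp_integratedSymbol hT.continuous hT.nonneg hT.growth ha.le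
  have hcont : Continuous fun h : ℝ => a⁻¹ * (√(∫ w, (‖(Real.fourierChar (-(w * h)) : ℂ) - 1‖ *
      integratedSymbol φ a w) ^ 2) * C) :=
    continuous_const.mul ((continuous_integral_norm_fourierChar_sub_sq hm).sqrt.mul
      continuous_const)
  obtain ⟨δ, hδ, H⟩ := Metric.continuous_iff.1 hcont 0 ε hε
  -- Halving turns the closed condition `|h| ≤ δ/2` into the strict one required by continuity at
  -- `0`.
  refine ⟨δ / 2, half_pos hδ, ?_⟩
  rintro h hh _ ⟨f, hf, rfl⟩ x _ _
  rw [hT.translateAverage_eq ha, hT.translateAverage_eq ha, ← smul_sub, norm_smul,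
    Real.norm_of_nonneg (inv_nonneg.2 ha.le)]
  have h1 := H h (by rw [Real.dist_eq, sub_zero]; linarith)
  simp only [Real.dist_eq, mul_zero, neg_zero, AddChar.map_zero_eq_one, Circle.coe_one, sub_self,
    norm_zero, zero_mul, ne_eq, OfNat.ofNat_ne_zero, not_false_eq_true, zero_pow, integral_zero,
    Real.sqrt_zero, sub_zero] at h1
  refine lt_of_le_of_lt ?_ ((le_abs_self _).trans_lt h1)
  refine mul_le_mul_of_nonneg_left ?_ (inv_nonneg.2 ha.le)
  refine (norm_fourier_mul_sub_le (integratedSymbol_nonneg φ a) hm _ x h).trans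
    (mul_le_mul_of_nonneg_left ?_ (Real.sqrt_nonneg _))
  exact ((Lp.fourierTransformₗᵢ ℝ ℂ).symm.norm_map f).trans_le (hC f hf)

end IsMultiplierTranslation

/-! ### Dilations and the normalisation of the transform -/

theorem eLpNorm_comp_mul_left {a : ℝ} (ha : a ≠ 0) {f : ℝ → ℂ}
    (hf : AEStronglyMeasurable f volume) :
    eLpNorm (fun x => f (a * x)) 2 volume =
      ENNReal.ofReal |a⁻¹| ^ (1 / 2 : ℝ≥0∞).toReal * eLpNorm f 2 volume := by
  have h : AEStronglyMeasurable f (Measure.map (fun x => a * x) volume) := by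
    rw [Real.map_volume_mul_left ha]
    exact hf.smul_measure _
  have h1 := eLpNorm_map_measure (p := 2) h (measurable_const_mul a).aemeasurable
  rw [Real.map_volume_mul_left ha, eLpNorm_smul_measure_of_ne_top (by norm_num), smul_eq_mul] at h1
  exact h1.symm

theorem UniformlySmallTails.smul_dilate {F : Set LineL2} (hF : UniformlySmallTails F) {a : ℝ}
    (ha : 0 < a) (c : ℂ) : UniformlySmallTails ((fun f => c • dilate a ha.ne' f) '' F) := by
  intro ε hε
  set q : ℝ≥0∞ := ENNReal.ofReal |a⁻¹| ^ (1 / 2 : ℝ≥0∞).toReal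
  have hq : q ≠ ∞ := (ENNReal.rpow_lt_top_of_nonneg (by positivity) (by simp)).ne
  set d : ℝ := ‖c‖ * q.toReal
  have hd : 0 ≤ d := by positivity
  -- The map `f ↦ c • dilate a f` multiplies tail norms by `d` and moves the radius from `R` to `R /
  -- a`; `d + 1` avoids division by zero.
  obtain ⟨R, hR, H⟩ := hF (ε / (d + 1)) (by positivity)
  refine ⟨R / a, by positivity, ?_⟩
  rintro _ ⟨f, hf, rfl⟩
  have h1 : c • dilate a ha.ne' f =ᵐ[volume] c • fun x => f (a * x) :=
    (Lp.coeFn_smul c _).trans ((coeFn_dilate ha.ne' f).const_smul c)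
  have h2 : (Ioo (-(R / a)) (R / a))ᶜ.indicator (fun x => f (a * x))
      = fun x => (Ioo (-R) R)ᶜ.indicator f (a * x) := by
    funext x
    have : x ∈ (Ioo (-(R / a)) (R / a))ᶜ ↔ a * x ∈ (Ioo (-R) R)ᶜ := by
      rw [mem_compl_iff, mem_compl_iff, mem_Ioo, mem_Ioo, ← neg_div, div_lt_iff₀ ha,
        lt_div_iff₀ ha, mul_comm x]
    by_cases h : x ∈ (Ioo (-(R / a)) (R / a))ᶜ
    · rw [indicator_of_mem h, indicator_of_mem (this.1 h)]
    · rw [indicator_of_notMem h, indicator_of_notMem (this.not.1 h)]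
  rw [eLpNorm_congr_ae (ae_restrict_of_ae h1), eLpNorm_const_smul,
    ← eLpNorm_indicator_eq_eLpNorm_restrict measurableSet_Ioo.compl, h2,
    eLpNorm_comp_mul_left ha.ne' ((Lp.aestronglyMeasurable f).indicator measurableSet_Ioo.compl),
    eLpNorm_indicator_eq_eLpNorm_restrict measurableSet_Ioo.compl]
  calc _ ≤ ENNReal.ofReal ‖c‖ * (ENNReal.ofReal q.toReal * ENNReal.ofReal (ε / (d + 1))) := by
        rw [ofReal_norm, ENNReal.ofReal_toReal hq]
        gcongr
        exact H f hf
    _ = ENNReal.ofReal (d * (ε / (d + 1))) := by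
        rw [← ENNReal.ofReal_mul (by positivity), ← ENNReal.ofReal_mul (by positivity), mul_assoc]
    _ ≤ ENNReal.ofReal ε := by
        refine ENNReal.ofReal_le_ofReal ?_
        rw [mul_div_assoc', div_le_iff₀ (by positivity)]
        nlinarith

theorem Bornology.IsBounded.image_dilate {F : Set LineL2} (hF : Bornology.IsBounded F) {a : ℝ}
    (ha : a ≠ 0) : Bornology.IsBounded (dilate a ha '' F) := by
  obtain ⟨C, hC⟩ := hF.exists_norm_le
  set q : ℝ≥0∞ := ENNReal.ofReal |a⁻¹| ^ (1 / 2 : ℝ≥0∞).toReal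
  refine (isBounded_iff_forall_norm_le).2 ⟨q.toReal * C, ?_⟩
  rintro _ ⟨f, hf, rfl⟩
  rw [Lp.norm_def, eLpNorm_congr_ae (coeFn_dilate ha f),
    eLpNorm_comp_mul_left ha (Lp.aestronglyMeasurable f), ENNReal.toReal_mul, ← Lp.norm_def]
  exact mul_le_mul_of_nonneg_left (hC f hf) ENNReal.toReal_nonneg

theorem two_pi_inv_ne_zero : ((2 * Real.pi)⁻¹ : ℝ) ≠ 0 := by positivity

/-- The transform `f̂(z) = 𝓕 f (z / 2π)` as an element of `L²(ℝ)`. -/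
noncomputable def angularFourier (f : LineL2) : LineL2 :=
  dilate (2 * Real.pi)⁻¹ two_pi_inv_ne_zero (𝓕 f)

theorem coeFn_angularFourier (f : LineL2) : angularFourier f =ᵐ[volume] fourierL2 f := by
  filter_upwards [coeFn_dilate two_pi_inv_ne_zero (𝓕 f)] with x hx
  rw [angularFourier, hx, fourierL2, div_eq_inv_mul]

theorem Bornology.IsBounded.image_angularFourier {F : Set LineL2} (hF : Bornology.IsBounded F) :
    Bornology.IsBounded (angularFourier '' F) := by
  have := ((Lp.fourierTransformₗᵢ ℝ ℂ).lipschitz.isBounded_image hF).image_dilate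
    two_pi_inv_ne_zero
  rwa [image_image] at this

/-- Transforming back returns `f` up to scaling, so continuity in time of `K̂` controls the spatial
tails of `K`. -/
theorem fourierInv_angularFourier (f : LineL2) : (𝓕⁻ (angularFourier f) : LineL2) =
    ((2 * Real.pi : ℝ) : ℂ) • dilate (2 * Real.pi) Real.two_pi_pos.ne' f := by
  rw [angularFourier, fourierInv_dilate, fourierInv_fourier_eq]
  simp only [inv_inv, abs_of_pos Real.two_pi_pos]

theorem uniformlySmallTails_fourierInv_angularFourier_iff {K : Set LineL2} :
    UniformlySmallTails ((fun f : LineL2 => (𝓕⁻ f : LineL2)) '' (angularFourier '' K)) ↔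
      UniformlySmallTails K := by
  simp only [image_image, fourierInv_angularFourier]
  refine ⟨fun h => ?_, fun h => h.smul_dilate Real.two_pi_pos _⟩
  have h1 := h.smul_dilate (inv_pos.2 Real.two_pi_pos) ((2 * Real.pi : ℝ) : ℂ)⁻¹
  have h2 : ((2 * Real.pi : ℝ) : ℂ) ≠ 0 := Complex.ofReal_ne_zero.2 Real.two_pi_pos.ne'
  have h3 : ∀ f : LineL2, dilate (2 * Real.pi)⁻¹ (inv_pos.2 Real.two_pi_pos).ne'
      (dilate (2 * Real.pi) Real.two_pi_pos.ne' f) = f := fun f => by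
    have := dilate_inv_dilate two_pi_inv_ne_zero f
    simpa only [inv_inv] using this
  simpa only [image_image, dilate_smul, h3, inv_smul_smul₀ h2, image_id'] using h1

/-! ### The compactness criterion for multiplier translations -/

namespace IsMultiplierTranslation

variable {T : ℝ → (ℝ → ℂ) → ℝ → ℂ} {φ : ℝ → ℝ}

theorem equicontinuousInTime_iff (hT : IsMultiplierTranslation T φ) {F : Set LineL2}
    (hF : Bornology.IsBounded F) :
    EquicontinuousInTime T univ (Ici 0) volume 2 ((fun f : LineL2 => (f : ℝ → ℂ)) '' F) ↔
      UniformlySmallTails ((fun f : LineL2 => (𝓕⁻ f : LineL2)) '' F) :=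
  ⟨hT.uniformlySmallTails_of_equicontinuousInTime,
    hT.equicontinuousInTime_of_uniformlySmallTails hF⟩

/-- Compactness in `L²(ℝ)` in terms of the continuity in time of the translates. -/
theorem isCompact_closure_iff (hT : IsMultiplierTranslation T φ) {K : Set LineL2}
    (hK : Bornology.IsBounded K) : IsCompact (closure K) ↔
      EquicontinuousInTime T univ (Ici 0) volume 2 ((fun f : LineL2 => (f : ℝ → ℂ)) '' K) ∧
      EquicontinuousInTime T univ (Ici 0) volume 2
        ((fun f : LineL2 => (f : ℝ → ℂ)) '' (angularFourier '' K)) := by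
  rw [hT.equicontinuousInTime_iff hK, hT.equicontinuousInTime_iff hK.image_angularFourier,
    uniformlySmallTails_fourierInv_angularFourier_iff, isCompact_closure_iff_uniformlySmallTails hK]

theorem apply_ae_eq (hT : IsMultiplierTranslation T φ) {t : ℝ} (ht : 0 ≤ t) {f g : ℝ → ℂ}
    (h : f =ᵐ[volume] g) : T t f =ᵐ[volume] T t g := by
  rcases ht.eq_or_lt with rfl | ht'
  · rwa [hT.zero_apply, hT.zero_apply]
  · rw [hT.congr_ae t ht' f g h]

/-- `T^0 f = f` depends on the representative, but `t = 0` is negligible in the time average. This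
allows `fourierL2 f` to be replaced by the `L²` class `angularFourier f`. -/
theorem translateAverage_congr (hT : IsMultiplierTranslation T φ) {f g : ℝ → ℂ}
    (h : f =ᵐ[volume] g) (a x : ℝ) :
    translateAverage T (Ici 0) volume a f x = translateAverage T (Ici 0) volume a g x := by
  rw [translateAverage, translateAverage, relBall_Ici_zero, integral_Ico_eq_integral_Ioo,
    integral_Ico_eq_integral_Ioo]
  congr 1
  exact setIntegral_congr_fun measurableSet_Ioo fun t ht => by rw [hT.congr_ae t ht.1 f g h]

theorem equicontinuousInTime_congr (hT : IsMultiplierTranslation T φ) {ι : Type*} {K : Set ι}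
    {f g : ι → ℝ → ℂ} (h : ∀ k ∈ K, f k =ᵐ[volume] g k) :
    EquicontinuousInTime T univ (Ici 0) volume 2 (f '' K) ↔
      EquicontinuousInTime T univ (Ici 0) volume 2 (g '' K) := by
  unfold EquicontinuousInTime
  simp only [forall_mem_image, Measure.restrict_univ]
  refine forall₂_congr fun ε _ => forall₂_congr fun M _ => exists_congr fun δ =>
    and_congr_right fun _ => forall₂_congr fun t ht => forall₂_congr fun s _ =>
    forall_congr' fun hts => forall₂_congr fun k hk => ?_
  have : (fun x => T (t + s) (f k) x - T t (f k) x) =ᵐ[volume]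
      fun x => T (t + s) (g k) x - T t (g k) x :=
    (hT.apply_ae_eq hts (h k hk)).sub (hT.apply_ae_eq ht.1 (h k hk))
  rw [eLpNorm_congr_ae this]

theorem equicontinuousAverages_congr (hT : IsMultiplierTranslation T φ) {ι : Type*} {K : Set ι}
    {f g : ι → ℝ → ℂ} (h : ∀ k ∈ K, f k =ᵐ[volume] g k) :
    EquicontinuousAverages T univ (Ici 0) volume (f '' K) ↔
      EquicontinuousAverages T univ (Ici 0) volume (g '' K) := by
  unfold EquicontinuousAverages
  simp only [forall_mem_image]
  refine forall₂_congr fun ε _ => forall₂_congr fun a _ => forall₂_congr fun R _ =>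
    exists_congr fun δ => and_congr_right fun _ => forall₂_congr fun s _ =>
    forall₂_congr fun k hk => ?_
  simp only [hT.translateAverage_congr (h k hk)]

/-- Compactness in `L²(ℝ)` in terms of equicontinuity in mean. -/
theorem isCompact_closure_iff_equicontinuousInMean (hT : IsMultiplierTranslation T φ)
    {K : Set LineL2} (hK : Bornology.IsBounded K) : IsCompact (closure K) ↔
      EquicontinuousInMean T univ (Ici 0) volume volume 2
        ((fun f : LineL2 => (f : ℝ → ℂ)) '' K) ∧
      EquicontinuousInMean T univ (Ici 0) volume volume 2 (fourierL2 '' K) := by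
  have e : ∀ f ∈ K, fourierL2 f =ᵐ[volume] angularFourier f :=
    fun f _ => (coeFn_angularFourier f).symm
  have h1 := hT.equicontinuousAverages hK
  have h2 := hT.equicontinuousAverages hK.image_angularFourier
  rw [EquicontinuousInMean, EquicontinuousInMean, hT.equicontinuousInTime_congr e,
    hT.equicontinuousAverages_congr e, hT.isCompact_closure_iff hK]
  rw [image_image] at h2 ⊢
  simp only [h1, h2, and_true]

end IsMultiplierTranslation

/-! ### The heat and Poisson kernels -/

theorem fourierInv_exp_neg_sq {b t : ℝ} (hb : 0 < b) (ht : 0 < t) (y : ℝ) :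
    𝓕⁻ (fun w : ℝ => (Real.exp (-(t * (b ^ 2 * (2 * Real.pi * w) ^ 2))) : ℂ)) y =
      (Real.exp (-y ^ 2 / (4 * b ^ 2 * t)) / (2 * b * √Real.pi * √t) : ℝ) := by
  have hπ := Real.pi_pos
  -- Chosen so that the multiplier is `exp (-π s w²)`, whose transform is `s^(-1/2) exp (-π y² /
  -- s)`.
  set s : ℝ := 4 * Real.pi * b ^ 2 * t
  have hs : 0 < s := by positivity
  have h1 : (fun w : ℝ => (Real.exp (-(t * (b ^ 2 * (2 * Real.pi * w) ^ 2))) : ℂ))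
      = fun w : ℝ => Complex.exp (-Real.pi * (s : ℂ) * w ^ 2) := by
    funext w
    rw [Complex.ofReal_exp]
    congr 1
    simp only [s]
    push_cast
    ring
  have h2 : ((s : ℂ) ^ (1 / 2 : ℂ)) = (2 * b * √Real.pi * √t : ℝ) := by
    have : (1 / 2 : ℂ) = ((1 / 2 : ℝ) : ℂ) := by norm_num
    rw [this, ← Complex.ofReal_cpow hs.le, ← Real.sqrt_eq_rpow]
    congr 1
    rw [Real.sqrt_eq_iff_mul_self_eq hs.le (by positivity)]
    have e1 := Real.mul_self_sqrt hπ.le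
    have e2 := Real.mul_self_sqrt ht.le
    refine Eq.symm ?_
    calc (2 * b * √Real.pi * √t) * (2 * b * √Real.pi * √t)
        = 4 * b ^ 2 * (√Real.pi * √Real.pi) * (√t * √t) := by ring
      _ = s := by rw [e1, e2]; ring
  rw [Real.fourierInv_eq_fourier_neg, h1, fourier_gaussian_pi (by simpa using hs)]
  simp only
  rw [h2, one_div, inv_mul_eq_div, Complex.ofReal_div, Complex.ofReal_exp]
  congr 2
  simp only [s]
  push_cast
  have : (b : ℂ) ≠ 0 := Complex.ofReal_ne_zero.2 hb.ne'
  have : (t : ℂ) ≠ 0 := Complex.ofReal_ne_zero.2 ht.ne'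
  have : (Real.pi : ℂ) ≠ 0 := Complex.ofReal_ne_zero.2 hπ.ne'
  field_simp

theorem heatTranslation_isMultiplierTranslation {b : ℝ} (hb : 0 < b) :
    IsMultiplierTranslation (heatTranslation b) fun w => b ^ 2 * (2 * Real.pi * w) ^ 2 := by
  have hc : Continuous fun w : ℝ => b ^ 2 * (2 * Real.pi * w) ^ 2 := by fun_prop
  have h0 : ∀ w : ℝ, 0 ≤ b ^ 2 * (2 * Real.pi * w) ^ 2 := fun w => by positivity
  have hg : ∃ c > 0, ∀ w : ℝ, 1 ≤ |w| → c * |w| ≤ b ^ 2 * (2 * Real.pi * w) ^ 2 := by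
    refine ⟨b ^ 2 * (2 * Real.pi) ^ 2, by positivity, fun w hw => ?_⟩
    rw [mul_pow (2 * Real.pi) w, ← sq_abs w, ← mul_assoc]
    exact mul_le_mul_of_nonneg_left (le_self_pow₀ hw two_ne_zero) (by positivity)
  refine ⟨fun f => ?_, fun t ht f g hfg => ?_, fun t ht f x => ?_, hc, h0, hg⟩
  · funext x
    rw [heatTranslation, if_pos rfl]
  · funext x
    rw [heatTranslation, heatTranslation, if_neg ht.ne', if_neg ht.ne']
    exact integral_congr_ae (hfg.mono fun ξ hξ => by simp only [hξ])
  · rw [heatTranslation, if_neg ht.ne']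
    exact integral_kernel_eq_fourier
      (k := fun y => Real.exp (-y ^ 2 / (4 * b ^ 2 * t)) / (2 * b * √Real.pi * √t))
      (integrable_exp_neg_mul hc h0 hg ht) (memLp_exp_neg_mul hc h0 hg ht)
      (fourierInv_exp_neg_sq hb ht) f x

/-- Splitting at `w = 0` removes the absolute value. The two halves are exponential integrals with
rates `q` and `p`, of sum `1/q - 1/p = (p - q)/(pq)`. -/
theorem fourierInv_exp_neg_abs {t : ℝ} (ht : 0 < t)
    (hi : Integrable fun w : ℝ => Real.exp (-(t * (2 * Real.pi * |w|)))) (y : ℝ) :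
    𝓕⁻ (fun w : ℝ => (Real.exp (-(t * (2 * Real.pi * |w|))) : ℂ)) y =
      (Real.pi⁻¹ * (t / (y ^ 2 + t ^ 2)) : ℝ) := by
  have hπ := Real.pi_pos
  set p : ℂ := ((-(2 * Real.pi * t) : ℝ) : ℂ) + ((2 * Real.pi * y : ℝ) : ℂ) * Complex.I
  set q : ℂ := ((2 * Real.pi * t : ℝ) : ℂ) + ((2 * Real.pi * y : ℝ) : ℂ) * Complex.I
  have hp : p.re = -(2 * Real.pi * t) := by simp [p]
  have hq : q.re = 2 * Real.pi * t := by simp [q]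
  have hp0 : p.re < 0 := by rw [hp]; exact neg_lt_zero.2 (by positivity)
  have hq0 : 0 < q.re := by rw [hq]; positivity
  set F : ℝ → ℂ := fun w => Real.fourierChar (w * y) • (Real.exp (-(t * (2 * Real.pi * |w|))) : ℂ)
  have hF : Integrable F := by
    have := integrable_fourierChar_smul (-y)
      (p := fun w : ℝ => (Real.exp (-(t * (2 * Real.pi * |w|))) : ℂ)) hi.ofReal
    simpa only [F, mul_neg, neg_neg] using this
  have hFw : ∀ w, F w = Complex.exp (((2 * Real.pi * (w * y) : ℝ) : ℂ) * Complex.I +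
      ((-(t * (2 * Real.pi * |w|)) : ℝ) : ℂ)) := fun w => by
    simp only [F]
    rw [Circle.smul_def, Real.fourierChar_apply, smul_eq_mul, Complex.ofReal_exp, ← Complex.exp_add]
  have h1 : ∫ w in Iic 0, F w = Complex.exp (q * (0 : ℝ)) / q := by
    rw [← integral_exp_mul_complex_Iic hq0]
    refine setIntegral_congr_fun measurableSet_Iic fun w hw => ?_
    rw [hFw, abs_of_nonpos hw]
    congr 1
    simp only [q]
    push_cast
    ring
  have h2 : ∫ w in Ioi 0, F w = -Complex.exp (p * (0 : ℝ)) / p := by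
    rw [← integral_exp_mul_complex_Ioi hp0]
    refine setIntegral_congr_fun measurableSet_Ioi fun w hw => ?_
    rw [hFw, abs_of_pos hw]
    congr 1
    simp only [p]
    push_cast
    ring
  have hpz : p ≠ 0 := fun h => by simp [h] at hp0
  have hqz : q ≠ 0 := fun h => by simp [h] at hq0
  have hpq : p * q = ((-(4 * Real.pi ^ 2 * (y ^ 2 + t ^ 2)) : ℝ) : ℂ) := by
    simp only [p, q]
    push_cast
    linear_combination (4 * (Real.pi : ℂ) ^ 2 * y ^ 2) * Complex.I_sq
  have hpq' : p - q = ((-(4 * Real.pi * t) : ℝ) : ℂ) := by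
    simp only [p, q]
    push_cast
    ring
  have hF0 : 𝓕⁻ (fun w : ℝ => (Real.exp (-(t * (2 * Real.pi * |w|))) : ℂ)) y = ∫ w, F w := by
    rw [Real.fourierInv_eq]
    refine integral_congr_ae (ae_of_all _ fun w => ?_)
    simp only [F, RCLike.inner_apply, conj_trivial, mul_comm y w]
  rw [hF0, ← intervalIntegral.integral_Iic_add_Ioi hF.integrableOn hF.integrableOn, h1, h2]
  have e : Complex.exp (q * (0 : ℝ)) / q + -Complex.exp (p * (0 : ℝ)) / p = (p - q) / (p * q) := by
    simp only [Complex.ofReal_zero, mul_zero, Complex.exp_zero]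
    field_simp
    ring
  rw [e, hpq, hpq', ← Complex.ofReal_div]
  congr 1
  have : 0 < y ^ 2 + t ^ 2 := by positivity
  field_simp

theorem poissonTranslation_isMultiplierTranslation :
    IsMultiplierTranslation poissonTranslation fun w => 2 * Real.pi * |w| := by
  have hc : Continuous fun w : ℝ => 2 * Real.pi * |w| := by fun_prop
  have h0 : ∀ w : ℝ, 0 ≤ 2 * Real.pi * |w| := fun w => by positivity
  have hg : ∃ c > 0, ∀ w : ℝ, 1 ≤ |w| → c * |w| ≤ 2 * Real.pi * |w| :=
    ⟨2 * Real.pi, Real.two_pi_pos, fun w _ => le_rfl⟩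
  refine ⟨fun f => ?_, fun t ht f g hfg => ?_, fun t ht f x => ?_, hc, h0, hg⟩
  · funext x
    rw [poissonTranslation, if_pos rfl]
  · funext x
    rw [poissonTranslation, poissonTranslation, if_neg ht.ne', if_neg ht.ne']
    congr 1
    exact integral_congr_ae (hfg.mono fun ξ hξ => by simp only [hξ])
  · have hi := integrable_exp_neg_mul hc h0 hg ht
    rw [poissonTranslation, if_neg ht.ne', ← integral_smul, ← integral_kernel_eq_fourier
      (k := fun y => Real.pi⁻¹ * (t / (y ^ 2 + t ^ 2)))
      hi (memLp_exp_neg_mul hc h0 hg ht) (fourierInv_exp_neg_abs ht hi) f x]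
    refine integral_congr_ae (ae_of_all _ fun ξ => ?_)
    simp only [smul_smul, sub_sq_comm x ξ]

/-! ### Even extension from the half line -/

/-- The Hilbert space `L²(0, ∞)`. -/
abbrev HalfLineL2 : Type := Lp ℂ 2 ((volume : Measure ℝ).restrict (Ioi (0 : ℝ)))

theorem lintegral_of_even {F : ℝ → ℝ≥0∞} (hF : ∀ x, F (-x) = F x) :
    ∫⁻ x, F x = 2 * ∫⁻ x in Ioi 0, F x := by
  have h := (Measure.measurePreserving_neg (volume : Measure ℝ)).setLIntegral_comp_preimage_emb
    (MeasurableEquiv.neg ℝ).measurableEmbedding F (Ioi 0)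
  have h1 : (Neg.neg : ℝ → ℝ) ⁻¹' Ioi 0 = Iio 0 := by
    ext x
    simp
  simp only [hF, h1] at h
  rw [← lintegral_add_compl F (measurableSet_Ioi (a := (0 : ℝ))), compl_Ioi,
    setLIntegral_congr Iio_ae_eq_Iic.symm, h, two_mul]

theorem eLpNorm_of_even {u : ℝ → ℂ} (hu : ∀ x, u (-x) = u x) :
    eLpNorm u 2 volume = 2 ^ (1 / 2 : ℝ) * eLpNorm u 2 (volume.restrict (Ioi 0)) := by
  rw [eLpNorm_eq_lintegral_rpow_enorm_toReal (by norm_num) (by norm_num),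
    eLpNorm_eq_lintegral_rpow_enorm_toReal (by norm_num) (by norm_num),
    lintegral_of_even (fun x => by rw [hu])]
  simp only [ENNReal.toReal_ofNat]
  rw [ENNReal.mul_rpow_of_nonneg _ _ (by norm_num)]

theorem coeFn_evenExtension (f : HalfLineL2) :
    evenExtension f =ᵐ[volume] fun x : ℝ => f |x| :=
  MemLp.coeFn_toLp _

theorem enorm_evenExtension_sub (f g : HalfLineL2) :
    ‖evenExtension f - evenExtension g‖ₑ = 2 ^ (1 / 2 : ℝ) * ‖f - g‖ₑ := by
  have h1 : (evenExtension f - evenExtension g : LineL2) =ᵐ[volume]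
      fun x : ℝ => f |x| - g |x| := by
    filter_upwards [Lp.coeFn_sub (evenExtension f) (evenExtension g), coeFn_evenExtension f,
      coeFn_evenExtension g] with x h1 h2 h3
    rw [h1, Pi.sub_apply, h2, h3]
  rw [Lp.enorm_def, Lp.enorm_def, eLpNorm_congr_ae h1,
    eLpNorm_of_even (fun x => by simp only [abs_neg])]
  congr 1
  refine eLpNorm_congr_ae ?_
  filter_upwards [Lp.coeFn_sub f g, ae_restrict_mem measurableSet_Ioi] with x hx hx0
  rw [hx, Pi.sub_apply, abs_of_pos hx0]

theorem dist_evenExtension (f g : HalfLineL2) :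
    dist (evenExtension f) (evenExtension g) = 2 ^ (1 / 2 : ℝ) * dist f g := by
  have h := congrArg ENNReal.toReal (enorm_evenExtension_sub f g)
  rw [ENNReal.toReal_mul, toReal_enorm, toReal_enorm, ← ENNReal.toReal_rpow] at h
  rw [dist_eq_norm, dist_eq_norm, h]
  rfl

/-- Distances are multiplied by `√2 ≥ 1`, so total boundedness passes in both directions. -/
theorem isUniformInducing_evenExtension : IsUniformInducing evenExtension := by
  have h1 : LipschitzWith (2 ^ (1 / 2 : ℝ)) evenExtension :=
    LipschitzWith.of_dist_le_mul fun f g => (dist_evenExtension f g).le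
  have h2 : AntilipschitzWith 1 evenExtension := AntilipschitzWith.of_le_mul_dist fun f g => by
    rw [dist_evenExtension, NNReal.coe_one, one_mul]
    exact le_mul_of_one_le_left dist_nonneg (Real.one_le_rpow (by norm_num) (by norm_num))
  exact h2.isUniformInducing h1.uniformContinuous

theorem Bornology.IsBounded.image_evenExtension {K : Set HalfLineL2} (hK : Bornology.IsBounded K) :
    Bornology.IsBounded (evenExtension '' K) := by
  have h1 : LipschitzWith (2 ^ (1 / 2 : ℝ)) evenExtension :=
    LipschitzWith.of_dist_le_mul fun f g => (dist_evenExtension f g).le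
  exact h1.isBounded_image hK

theorem isCompact_closure_image_evenExtension_iff {K : Set HalfLineL2} :
    IsCompact (closure (evenExtension '' K)) ↔ IsCompact (closure K) := by
  rw [isCompact_closure_iff_totallyBounded, isCompact_closure_iff_totallyBounded,
    totallyBounded_image_iff isUniformInducing_evenExtension]

/-- The kernel is invariant under `(ξ, x) ↦ (-ξ, -x)`. Evenness is thus preserved, and norms on the
line are determined on the half line. -/
theorem poissonTranslation_neg {g : ℝ → ℂ} (hg : ∀ x, g (-x) = g x) (t x : ℝ) :
    poissonTranslation t g (-x) = poissonTranslation t g x := by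
  unfold poissonTranslation
  split_ifs
  · exact hg x
  · congr 1
    rw [← integral_neg_eq_self]
    refine integral_congr_ae (ae_of_all _ fun ξ => ?_)
    have : (-ξ - -x) ^ 2 = (ξ - x) ^ 2 := by ring
    simp only [hg, this]

theorem equicontinuousInTime_halfLine_iff {F : Set (ℝ → ℂ)} :
    EquicontinuousInTime poissonTranslationHalfLine (Ioi 0) (Ici 0) volume 2 F ↔
      EquicontinuousInTime poissonTranslation univ (Ici 0) volume 2
        ((fun f ξ => f |ξ|) '' F) := by
  constructor
  · intro h ε hε M hM
    -- The norm on the line is `√2 ≤ 2` times that on the half line.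
    obtain ⟨δ, hδ, H⟩ := h (ε / 2) (half_pos hε) M hM
    refine ⟨δ, hδ, ?_⟩
    rintro t ht s hs hts _ ⟨f, hf, rfl⟩
    have h1 := H t ht s hs hts f hf
    rw [Measure.restrict_univ, eLpNorm_of_even fun x => by
      rw [poissonTranslation_neg (fun x => by simp only [abs_neg]),
        poissonTranslation_neg (fun x => by simp only [abs_neg])]]
    have h2 : (2 : ℝ≥0∞) ^ (1 / 2 : ℝ) ≤ 2 := by
      conv_rhs => rw [← ENNReal.rpow_one 2]
      exact ENNReal.rpow_le_rpow_of_exponent_le (by norm_num) (by norm_num)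
    have h3 : ENNReal.ofReal ε = 2 * ENNReal.ofReal (ε / 2) := by
      rw [← ENNReal.ofReal_ofNat 2, ← ENNReal.ofReal_mul (by norm_num)]
      congr 1
      ring
    rw [h3]
    exact (mul_le_mul_left h2 _).trans_lt
      ((ENNReal.mul_lt_mul_iff_right (by norm_num) (by norm_num)).2 h1)
  · intro h ε hε M hM
    obtain ⟨δ, hδ, H⟩ := h ε hε M hM
    refine ⟨δ, hδ, fun t ht s hs hts f hf => ?_⟩
    have h1 := H t ht s hs hts _ (mem_image_of_mem _ hf)
    rw [Measure.restrict_univ] at h1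
    exact (eLpNorm_restrict_le _ _ _ _).trans_lt h1

theorem EquicontinuousAverages.halfLine {F : Set (ℝ → ℂ)}
    (h : EquicontinuousAverages poissonTranslation univ (Ici 0) volume
      ((fun f ξ => f |ξ|) '' F)) :
    EquicontinuousAverages poissonTranslationHalfLine (Ioi 0) (Ici 0) volume F := by
  intro ε hε a ha R hR
  obtain ⟨δ, hδ, H⟩ := h ε hε a ha R hR
  exact ⟨δ, hδ, fun s hs f hf x hx hxs =>
    H s hs _ (mem_image_of_mem _ hf) x ⟨mem_univ _, hx.2⟩ ⟨mem_univ _, hxs.2⟩⟩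

/-- Reflection is dilation by `-1`; it fixes an even function, so the scaling law forces the
transform to be even. -/
theorem fourierL2_evenExtension_neg (f : HalfLineL2) :
    (fun z => fourierL2 (evenExtension f) (-z)) =ᵐ[volume] fourierL2 (evenExtension f) := by
  have hn : (-1 : ℝ) ≠ 0 := by norm_num
  set g := evenExtension f
  have h1 : dilate (-1) hn g = g := by
    refine Lp.ext ?_
    filter_upwards [coeFn_dilate hn g, ae_eq_comp_mul_left hn (coeFn_evenExtension f),
      coeFn_evenExtension f] with x h1 h2 h3
    rw [h1, h2, h3, neg_one_mul, abs_neg]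
  have h2 := fourier_dilate hn g
  rw [h1] at h2
  have h3 : (𝓕 g : LineL2) =ᵐ[volume] fun x => (𝓕 g : LineL2) (-1 * x) := by
    have e : (|(-1 : ℝ)⁻¹| : ℝ) = 1 := by norm_num
    rw [e, Complex.ofReal_one, one_smul] at h2
    have h4 := coeFn_dilate (inv_ne_zero hn) (𝓕 g)
    rw [← h2] at h4
    simpa only [inv_neg, inv_one] using h4
  filter_upwards [ae_eq_comp_mul_left two_pi_inv_ne_zero h3] with z hz
  rw [fourierL2, fourierL2, div_eq_inv_mul, div_eq_inv_mul, hz]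
  congr 1
  ring

/-- By evenness the two exponentials in the cosine contribute equally, so even extension carries the
cosine transform to the Fourier transform. -/
theorem cosineL2_abs_ae_eq (f : HalfLineL2) :
    (fun ξ : ℝ => cosineL2 f |ξ|) =ᵐ[volume] angularFourier (evenExtension f) := by
  filter_upwards [fourierL2_evenExtension_neg f, coeFn_angularFourier (evenExtension f)] with z h1 h2
  rw [h2, cosineL2]
  rcases abs_choice z with h | h
  · rw [h, h1]
    ring
  · rw [h, neg_neg, h1]
    ring

theorem isCompact_closure_iff_equicontinuousInMean_halfLine {K : Set HalfLineL2}
    (hK : Bornology.IsBounded K) : IsCompact (closure K) ↔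
      EquicontinuousInMean poissonTranslationHalfLine (Ioi 0) (Ici 0) volume volume 2
        ((fun f : HalfLineL2 => (f : ℝ → ℂ)) '' K) ∧
      EquicontinuousInMean poissonTranslationHalfLine (Ioi 0) (Ici 0) volume volume 2
        (cosineL2 '' K) := by
  have hT := poissonTranslation_isMultiplierTranslation
  have hE := hK.image_evenExtension
  have e1 : ∀ f ∈ K, (fun ξ : ℝ => f |ξ|) =ᵐ[volume] evenExtension f :=
    fun f _ => (coeFn_evenExtension f).symm
  have e2 : ∀ f ∈ K, (fun ξ : ℝ => cosineL2 f |ξ|) =ᵐ[volume] angularFourier (evenExtension f) :=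
    fun f _ => cosineL2_abs_ae_eq f
  have a1 : EquicontinuousAverages poissonTranslationHalfLine (Ioi 0) (Ici 0) volume
      ((fun f : HalfLineL2 => (f : ℝ → ℂ)) '' K) := by
    refine EquicontinuousAverages.halfLine ?_
    have := hT.equicontinuousAverages hE
    rw [image_image] at this ⊢
    exact (hT.equicontinuousAverages_congr e1).2 this
  have a2 : EquicontinuousAverages poissonTranslationHalfLine (Ioi 0) (Ici 0) volume
      (cosineL2 '' K) := by
    refine EquicontinuousAverages.halfLine ?_
    have := hT.equicontinuousAverages hE.image_angularFourier
    rw [image_image, image_image] at this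
    rw [image_image]
    exact (hT.equicontinuousAverages_congr e2).2 this
  -- Boundedness has settled both conditions on averages; only continuity in time remains to be
  -- carried to the line.
  simp only [EquicontinuousInMean, a1, a2, and_true]
  rw [← isCompact_closure_image_evenExtension_iff, hT.isCompact_closure_iff hE,
    equicontinuousInTime_halfLine_iff, equicontinuousInTime_halfLine_iff]
  simp only [image_image]
  rw [hT.equicontinuousInTime_congr e1, hT.equicontinuousInTime_congr e2]

theorem mainTheorem4 :
    (∀ b : ℝ, 0 < b → ∀ K : Set (Lp ℂ 2 (volume : Measure ℝ)), Bornology.IsBounded K →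
      (IsCompact (closure K) ↔
        EquicontinuousInMean (heatTranslation b) univ (Ici 0) volume volume 2
          ((fun f : Lp ℂ 2 (volume : Measure ℝ) => (f : ℝ → ℂ)) '' K) ∧
        EquicontinuousInMean (heatTranslation b) univ (Ici 0) volume volume 2
          (fourierL2 '' K))) ∧
    (∀ K : Set (Lp ℂ 2 (volume.restrict (Ioi (0 : ℝ)))), Bornology.IsBounded K →
      (IsCompact (closure K) ↔
        EquicontinuousInMean poissonTranslationHalfLine (Ioi 0) (Ici 0) volume volume 2
          ((fun f : Lp ℂ 2 (volume.restrict (Ioi (0 : ℝ))) => (f : ℝ → ℂ)) '' K) ∧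
        EquicontinuousInMean poissonTranslationHalfLine (Ioi 0) (Ici 0) volume volume 2
          (cosineL2 '' K))) :=
  ⟨fun _ hb _ hK =>
    (heatTranslation_isMultiplierTranslation hb).isCompact_closure_iff_equicontinuousInMean hK,
    fun _ hK => isCompact_closure_iff_equicontinuousInMean_halfLine hK⟩
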